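/- Let $N\ge 2$ and $2<p<2_*:=\frac{2N+2}{N-1}$. All functions are complex-valued, $B\subset\mathbb{R}^N$ is the open unit ball, and $H^2_0(B)\subset H^2(\mathbb{R}^N)$ is the closure of $C_c^\infty(B)$ in $H^2(\mathbb{R}^N)$. For $a,b>0$, $\Omega\in\{\mathbb{R}^N,B\}$, and $X=H^2(\mathbb{R}^N)$ if $\Omega=\mathbb{R}^N$, $X=H^2_0(B)$ if $\Omega=B$, call $u\in X\setminus\{0\}$ a ground state solution of $$\Delta^2u+2a\Delta u+bu-|u|^{p-2}u=0\quad\text{in }\Omega \qquad (*)$$ (with Dirichlet conditions $u=\partial_\nu u=0$ on $\partial B$ if $\Omega=B$) if $u$ solves $(*)$ in the sense of distributions and attains the infimum $$\inf_{v\in X\setminus\{0\}}\frac{\int_\Omega\bigl(|\Delta v|^2-2a|\nabla v|^2+b|v|^2\bigr)\,dx}{\|v\|_{L^p(\Omega)}^2}.$$ Then there exists $\varepsilon_0=\varepsilon_0(p)>0$ (depending only on $N$ and $p$) such that the following hold. 1. For $0<\varepsilon\le\varepsilon_0$, every ground state solution $u\in H^2(\mathbb{R}^N)$ of $\Delta^2u+2\Delta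 u+(1+\varepsilon)u-|u|^{p-2}u=0$ in $\mathbb{R}^N$ is a nonradial function. 2. For every $0<\varepsilon\le\varepsilon_0$ there exists $a_0=a_0(\varepsilon,p)>0$ (depending only on $N$, $p$ and $\varepsilon$) such that, if $a>a_0$ and $b=(1+\varepsilon)a^2$, every ground state solution $u\in H^2_0(B)$ of the Dirichlet problem $$\Delta^2u+2a\Delta u+bu-|u|^{p-2}u=0\ \text{ in }B,\qquad u=\partial_\nu u=0\ \text{ on }\partial B,$$ is a nonradial function. Here a function is radial if it agrees almost everywhere with a function of $|x|$. -/

import Mathlib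

open MeasureTheory Filter Topology
open scoped SchwartzMap LineDeriv Laplacian

noncomputable section

namespace BiharmonicNLS

/-- The Euclidean space `ℝ^N`. -/
abbrev E (N : ℕ) : Type := EuclideanSpace ℝ (Fin N)

/-- The space `L²(ℝ^N; ℂ)`. -/
abbrev L2 (N : ℕ) : Type := Lp ℂ 2 (volume : Measure (E N))

open Classical in
/-- The `L²` function that represents a tempered distribution (`0` if there is none). -/
def l2Rep {N : ℕ} (T : 𝓢'(E N, ℂ)) : L2 N :=
  if h : ∃ f : L2 N, Lp.toTemperedDistribution f = T then h.choose else 0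

/-- The representing `L²` function is unique. -/
theorem l2Rep_eq {N : ℕ} {T : 𝓢'(E N, ℂ)} {f : L2 N}
    (hf : Lp.toTemperedDistribution f = T) : l2Rep T = f := by
  have h : ∃ f : L2 N, Lp.toTemperedDistribution f = T := ⟨f, hf⟩
  have h1 : l2Rep T = h.choose := by rw [l2Rep, dif_pos h]
  have h2 : Lp.toTemperedDistribution h.choose = T := h.choose_spec
  rw [h1]
  have hinj : Function.Injective (Lp.toTemperedDistributionCLM ℂ (volume : Measure (E N)) 2) :=
    LinearMap.ker_eq_bot.mp Lp.ker_toTemperedDistributionCLM_eq_bot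
  apply hinj
  simp only [Lp.toTemperedDistributionCLM_apply]
  rw [h2, hf]

/-- The weak partial derivative `∂ᵢ u`. -/
def weakDeriv {N : ℕ} (i : Fin N) (u : L2 N) : L2 N :=
  l2Rep (∂_{(EuclideanSpace.single i (1 : ℝ) : E N)} (Lp.toTemperedDistribution u))

/-- The weak second partial derivative `∂ᵢ ∂ⱼ u`. -/
def weakDeriv₂ {N : ℕ} (i j : Fin N) (u : L2 N) : L2 N :=
  l2Rep (∂_{(EuclideanSpace.single i (1 : ℝ) : E N)}
    (∂_{(EuclideanSpace.single j (1 : ℝ) : E N)} (Lp.toTemperedDistribution u)))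

/-- The weak Laplacian `Δ u`. -/
def weakLaplacian {N : ℕ} (u : L2 N) : L2 N :=
  l2Rep (Δ (Lp.toTemperedDistribution u))

/-- The Sobolev space `H²(ℝ^N)`. -/
def H2 (N : ℕ) : Set (L2 N) :=
  {u | TemperedDistribution.MemSobolev 2 2 (Lp.toTemperedDistribution u)}

/-- The square of the `H²` norm. -/
def h2NormSq {N : ℕ} (u : L2 N) : ℝ :=
  ‖u‖ ^ 2 + ∑ i, ‖weakDeriv i u‖ ^ 2 + ∑ i, ∑ j, ‖weakDeriv₂ i j u‖ ^ 2

/-- The space `H²₀(Ω) ⊆ H²(ℝ^N)`: the closure of `C_c^∞(Ω)` with respect to the `H²` norm. -/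
def H20 {N : ℕ} (Ω : Set (E N)) : Set (L2 N) :=
  {u | u ∈ H2 N ∧ ∃ φ : ℕ → 𝓢(E N, ℂ),
    (∀ n, HasCompactSupport (φ n) ∧ tsupport (φ n) ⊆ Ω) ∧
    Tendsto (fun n => h2NormSq (u - (φ n).toLp 2 volume)) atTop (𝓝 0)}

/-- The quadratic form `∫_Ω (|Δu|² - 2a|∇u|² + b|u|²) dx`. -/
def quadForm {N : ℕ} (Ω : Set (E N)) (a b : ℝ) (u : L2 N) : ℝ :=
  ∫ x in Ω, (‖weakLaplacian u x‖ ^ 2 - 2 * a * ∑ i, ‖weakDeriv i u x‖ ^ 2 + b * ‖u x‖ ^ 2)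

/-- The norm of `u` in `L^p(Ω)`. -/
def lpNormOn {N : ℕ} (Ω : Set (E N)) (p : ℝ) (u : L2 N) : ℝ :=
  (eLpNorm u (ENNReal.ofReal p) (volume.restrict Ω)).toReal

/-- The quotient `q_{a,b,Ω}(u) / ‖u‖²_{L^p(Ω)}`. -/
def quotient {N : ℕ} (Ω : Set (E N)) (a b p : ℝ) (u : L2 N) : ℝ :=
  quadForm Ω a b u / lpNormOn Ω p u ^ 2

/-- `u` satisfies `Δ²u + 2aΔu + bu - |u|^{p-2}u = 0` in `Ω` in the sense of distributions. -/
def SolvesEquation {N : ℕ} (Ω : Set (E N)) (a b p : ℝ) (u : L2 N) : Prop :=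
  ∀ φ : 𝓢(E N, ℂ), HasCompactSupport φ → tsupport φ ⊆ Ω →
    Lp.toTemperedDistribution u (Δ (Δ φ)) + 2 * (a : ℂ) * Lp.toTemperedDistribution u (Δ φ)
      + (b : ℂ) * Lp.toTemperedDistribution u φ
      - ∫ x in Ω, ((‖u x‖ ^ (p - 2) : ℝ) : ℂ) * u x * φ x = 0

/-- `u ∈ X \ {0}` solves the equation in `Ω` and attains the infimum of the quotient
over `X \ {0}`. -/
def IsGroundStateIn {N : ℕ} (X : Set (L2 N)) (Ω : Set (E N)) (a b p : ℝ) (u : L2 N) : Prop :=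
  u ∈ X ∧ u ≠ 0 ∧ SolvesEquation Ω a b p u ∧
    IsLeast {t : ℝ | ∃ v ∈ X, v ≠ 0 ∧ t = quotient Ω a b p v} (quotient Ω a b p u)

/-- Ground state solutions of `Δ²u + 2aΔu + bu = |u|^{p-2}u` in `ℝ^N`. -/
def IsGroundState {N : ℕ} (a b p : ℝ) (u : L2 N) : Prop :=
  IsGroundStateIn (H2 N) Set.univ a b p u

/-- Ground state solutions of the Dirichlet problem `Δ²u + 2aΔu + bu = |u|^{p-2}u` in the open
unit ball `B`, `u = ∂_ν u = 0` on `∂B`; the boundary condition is membership in `H²₀(B)`. -/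
def IsDirichletGroundState {N : ℕ} (a b p : ℝ) (u : L2 N) : Prop :=
  IsGroundStateIn (H20 (Metric.ball (0 : E N) 1)) (Metric.ball (0 : E N) 1) a b p u

/-- `u` is radial: it agrees almost everywhere with a function of `|x|`. -/
def IsRadial {N : ℕ} (u : L2 N) : Prop :=
  ∃ f : ℝ → ℂ, ∀ᵐ x : E N, u x = f ‖x‖

end BiharmonicNLS

end

/-!
The equation itself plays no role; only the minimising property is used. With `a = l²` and
`b = (1 + δ²) a²`, `δ = √ε`, completing the square (`quadForm_univ`) turns the quadratic form into
`Q(u) = ‖Δu + l² u‖² + δ² l⁴ ‖u‖²`. For small `δ` a function with small quotient concentrates in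
frequency near the sphere of radius `l`, and the question is how much `L^p` norm such a function
can have.

*Knapp examples* (`exists_knapp`). A plane wave of frequency `l`, cut off on a box of length
`(l δ)⁻¹` along the wave and `(l √δ)⁻¹` across it, satisfies `‖Δv + l² v‖ ≲ δ l² ‖v‖`. This gives
test functions, supported in a ball of radius `(l δ)⁻¹`, with `Q(v)^(p/2) ≲ δ^e ‖v‖_p^p`, where `e`
is `knappExp` and powers of `l` are suppressed.

*Radial functions* (`radial_lower_bound`). A radial `u` solves the ordinary differential equation
`U'' + (n/r) U' + U = F` with `n = N - 1` and `F = Δu + u`, after rescaling to `l = 1`. The energy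
`r^n (|U'|² + |U|²)` is nearly conserved: up to lower order terms its derivative is at most
`r^n |F| (|U| + |U'|)`, whose integral is at most `‖F‖ (‖u‖ + ‖∇u‖) ≲ Q / δ`. Hence
`|u(x)| ≲ √(Q/δ) |x|^(-n/2)` away from the origin, with a singularity at the origin whose `p`-th
power is integrable (`radial_ode_bound`, `radial_pointwise_bound`). Integrating the `p`-th power up
to radius `1/δ`, and using the `L²` bound `‖u‖² ≤ Q/δ²` beyond, yields
`‖u‖_p^p ≲ δ^(τ - e) Q^(p/2)`; the gain `τ` is positive because `2 < p < 2_*`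
(`radial_lintegral_bound`). Mollification with radial
kernels extends this from smooth functions to `H²`.

A radial minimiser has a quotient not larger than that of the Knapp example, and the two estimates
combine to `1 ≤ C δ^τ` (`radial_not_below_knapp`), which is false for small `δ`. In the ball,
functions in `H²₀` and their weak derivatives vanish almost everywhere outside
(`H20_ae_eq_zero`), so the quotient is the one on the whole space, and the Knapp example is
admissible as soon as `l δ > 1`.
-/

noncomputable section

namespace BiharmonicNLS

open TemperedDistribution
open scoped FourierTransform ENNReal ContDiff Convolution

/-! ### Weak derivatives and the quadratic form -/

section WeakDerivatives

variable {N : ℕ}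

theorem toTD_injective : Function.Injective
    (Lp.toTemperedDistribution : L2 N → 𝓢'(E N, ℂ)) := by
  intro f g h
  rw [← l2Rep_eq h, l2Rep_eq rfl]

theorem toTD_add (f g : L2 N) : Lp.toTemperedDistribution (f + g) =
    Lp.toTemperedDistribution f + Lp.toTemperedDistribution g :=
  map_add (Lp.toTemperedDistributionCLM ℂ (volume : Measure (E N)) 2) f g

theorem toTD_sub (f g : L2 N) : Lp.toTemperedDistribution (f - g) =
    Lp.toTemperedDistribution f - Lp.toTemperedDistribution g :=
  map_sub (Lp.toTemperedDistributionCLM ℂ (volume : Measure (E N)) 2) f g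

theorem toTD_sum {ι : Type*} (s : Finset ι) (f : ι → L2 N) :
    Lp.toTemperedDistribution (∑ i ∈ s, f i) = ∑ i ∈ s, Lp.toTemperedDistribution (f i) :=
  map_sum (Lp.toTemperedDistributionCLM ℂ (volume : Measure (E N)) 2) f s

/-- `l2Rep` does not return its junk value when a representative exists. -/
theorem toTD_l2Rep {T : 𝓢'(E N, ℂ)} (h : ∃ f : L2 N, Lp.toTemperedDistribution f = T) :
    Lp.toTemperedDistribution (l2Rep T) = T := by
  obtain ⟨f, hf⟩ := h
  rw [l2Rep_eq hf, hf]

theorem exists_rep_of_memSobolev {s : ℝ} (hs : 0 ≤ s) {T : 𝓢'(E N, ℂ)} (hT : MemSobolev s 2 T) :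
    ∃ f : L2 N, Lp.toTemperedDistribution f = T := by
  obtain ⟨f, hf⟩ := memSobolev_zero_iff.mp (hT.mono hs)
  exact ⟨f, hf.symm⟩

theorem toTD_weakDeriv {u : L2 N} (hu : u ∈ H2 N) (i : Fin N) :
    Lp.toTemperedDistribution (weakDeriv i u) =
      ∂_{(EuclideanSpace.single i (1 : ℝ) : E N)} (Lp.toTemperedDistribution u) :=
  toTD_l2Rep <| exists_rep_of_memSobolev (s := 2 - 1) (by norm_num)
    (MemSobolev.lineDerivOp (m := EuclideanSpace.single i (1 : ℝ)) hu)

theorem toTD_weakDeriv₂ {u : L2 N} (hu : u ∈ H2 N) (i j : Fin N) :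
    Lp.toTemperedDistribution (weakDeriv₂ i j u) =
      ∂_{(EuclideanSpace.single i (1 : ℝ) : E N)}
        (∂_{(EuclideanSpace.single j (1 : ℝ) : E N)} (Lp.toTemperedDistribution u)) :=
  toTD_l2Rep <| exists_rep_of_memSobolev (s := 2 - 1 - 1) (by norm_num)
    (MemSobolev.lineDerivOp (m := EuclideanSpace.single i (1 : ℝ))
      (MemSobolev.lineDerivOp (m := EuclideanSpace.single j (1 : ℝ)) hu))

theorem toTD_weakLaplacian {u : L2 N} (hu : u ∈ H2 N) :
    Lp.toTemperedDistribution (weakLaplacian u) = Δ (Lp.toTemperedDistribution u) :=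
  toTD_l2Rep <| exists_rep_of_memSobolev (s := 2 - 2) (by norm_num) (MemSobolev.laplacian hu)

theorem weakLaplacian_eq_sum {u : L2 N} (hu : u ∈ H2 N) :
    weakLaplacian u = ∑ i, weakDeriv₂ i i u := by
  apply toTD_injective
  rw [toTD_weakLaplacian hu, toTD_sum,
    TemperedDistribution.laplacian_eq_sum (EuclideanSpace.basisFun (Fin N) ℝ)]
  refine Finset.sum_congr rfl fun i _ => ?_
  rw [toTD_weakDeriv₂ hu, EuclideanSpace.basisFun_apply]

/-- If multiplication by a function of temperate growth maps one `L²` function to another in the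
sense of distributions, then it does so almost everywhere. -/
theorem ae_eq_mul_of_smulLeftCLM {h : E N → ℂ} (hh : h.HasTemperateGrowth) {f g : L2 N}
    (H : smulLeftCLM ℂ h (Lp.toTemperedDistribution f) = Lp.toTemperedDistribution g) :
    ∀ᵐ x, g x = h x * f x := by
  apply ae_eq_of_integral_contDiff_smul_eq
  · exact (Lp.memLp g).locallyIntegrable (by norm_num)
  · have := ((Lp.memLp f).locallyIntegrable (by norm_num)).continuous_mul
      (g := h) hh.1.continuous
    exact this
  · intro φ hφ hφc
    have h1 : HasCompactSupport (Complex.ofRealCLM ∘ φ) := hφc.comp_left rfl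
    have h2 : ContDiff ℝ ∞ (Complex.ofRealCLM ∘ φ) := by fun_prop
    have := congrArg (fun T : 𝓢'(E N, ℂ) => T (h1.toSchwartzMap h2)) H
    simp only [smulLeftCLM_apply_apply, Lp.toTemperedDistribution_apply] at this
    simp only [SchwartzMap.smulLeftCLM_apply_apply hh] at this
    simp at this
    simp only [Complex.real_smul]
    rw [← this]
    congr 1
    ext x
    ring

theorem inner_eq_integral (f g : L2 N) : inner ℂ f g = ∫ x, g x * (starRingEnd ℂ) (f x) := by
  rw [L2.inner_def]; simp [RCLike.inner_apply]

/-- Integration by parts for `L²` functions with an `L²` directional derivative. -/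
theorem inner_lineDeriv {m : E N} {u v g k : L2 N}
    (hg : Lp.toTemperedDistribution g = ∂_{m} (Lp.toTemperedDistribution u))
    (hk : Lp.toTemperedDistribution k = ∂_{m} (Lp.toTemperedDistribution v)) :
    inner ℂ g v = - inner ℂ u k := by
  -- on the Fourier side the derivative is multiplication by `2πi⟪x, m⟫`, whose conjugate is its
  -- negative
  have key : ∀ {u g : L2 N}, Lp.toTemperedDistribution g = ∂_{m} (Lp.toTemperedDistribution u) →
      ∀ᵐ x, (𝓕 g : L2 N) x = (2 * Real.pi * Complex.I * (inner ℝ x m : ℝ)) * (𝓕 u : L2 N) x := by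
    intro u g h
    apply ae_eq_mul_of_smulLeftCLM (by fun_prop)
    rw [← Lp.fourier_toTemperedDistribution_eq, ← Lp.fourier_toTemperedDistribution_eq, h,
      fourier_lineDerivOp_eq]
    have : (fun x : E N => 2 * (Real.pi : ℂ) * Complex.I * ((inner ℝ x m : ℝ) : ℂ)) =
      (2 * (Real.pi : ℂ) * Complex.I) • (fun x : E N => ((inner ℝ x m : ℝ) : ℂ)) := by
      ext; simp
    rw [this, smulLeftCLM_smul (by fun_prop)]
    rfl
  rw [← Lp.inner_fourier_eq g v, ← Lp.inner_fourier_eq u k, inner_eq_integral, inner_eq_integral,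
    ← integral_neg]
  apply integral_congr_ae
  filter_upwards [key hg, key hk] with x h1 h2
  rw [h1, h2]
  simp only [map_mul, Complex.conj_I, Complex.conj_ofReal, map_ofNat]
  ring

theorem norm_sq_eq_integral (f : L2 N) : ‖f‖ ^ 2 = ∫ x, ‖f x‖ ^ 2 := by
  have h : inner ℂ f f = ((‖f‖ ^ 2 : ℝ) : ℂ) := by
    rw [inner_self_eq_norm_sq_to_K]; norm_cast
  rw [inner_eq_integral] at h
  have h2 : ∀ x, f x * (starRingEnd ℂ) (f x) = ((‖f x‖ ^ 2 : ℝ) : ℂ) := by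
    intro x; rw [Complex.mul_conj, Complex.normSq_eq_norm_sq]
  simp_rw [h2] at h
  rw [integral_complex_ofReal] at h
  exact_mod_cast h.symm

theorem integrable_norm_sq (f : L2 N) : Integrable (fun x => ‖f x‖ ^ 2) :=
  (memLp_two_iff_integrable_sq_norm (Lp.memLp f).1).mp (Lp.memLp f)

theorem sum_norm_sq_weakDeriv {u : L2 N} (hu : u ∈ H2 N) :
    ∑ i, ‖weakDeriv i u‖ ^ 2 = - (inner ℂ (weakLaplacian u) u).re := by
  rw [weakLaplacian_eq_sum hu, sum_inner, Complex.re_sum, ← Finset.sum_neg_distrib]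
  refine Finset.sum_congr rfl fun i _ => ?_
  rw [inner_lineDeriv (u := weakDeriv i u) (k := weakDeriv i u)
    (m := EuclideanSpace.single i (1 : ℝ))
    (by rw [toTD_weakDeriv₂ hu, toTD_weakDeriv hu]) (toTD_weakDeriv hu i),
    inner_self_eq_norm_sq_to_K]
  simp [← Complex.ofReal_pow]

theorem quadForm_eq_norms {u : L2 N} (a b : ℝ) :
    quadForm Set.univ a b u =
      ‖weakLaplacian u‖ ^ 2 - 2 * a * ∑ i, ‖weakDeriv i u‖ ^ 2 + b * ‖u‖ ^ 2 := by
  rw [quadForm, Measure.restrict_univ, norm_sq_eq_integral u, norm_sq_eq_integral (weakLaplacian u)]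
  simp_rw [norm_sq_eq_integral (weakDeriv _ u)]
  have hi := fun i => integrable_norm_sq (weakDeriv i u)
  rw [← integral_finsetSum _ fun i _ => hi i, ← integral_const_mul, ← integral_const_mul,
    ← integral_sub (integrable_norm_sq _) ((integrable_finsetSum _ fun i _ => hi i).const_mul _),
    ← integral_add _ ((integrable_norm_sq u).const_mul _)]
  exact (integrable_norm_sq _).sub ((integrable_finsetSum _ fun i _ => hi i).const_mul _)

/-- Completing the square in the quadratic form, by `‖∇u‖² = -Re ⟪Δu, u⟫`. For `b = (1 + δ²) a²`
the form equals `‖Δu + a u‖² + δ² a² ‖u‖²`. -/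
theorem quadForm_univ {u : L2 N} (hu : u ∈ H2 N) (a b : ℝ) :
    quadForm Set.univ a b u =
      ‖weakLaplacian u + (a : ℂ) • u‖ ^ 2 + (b - a ^ 2) * ‖u‖ ^ 2 := by
  rw [quadForm_eq_norms, sum_norm_sq_weakDeriv hu, @norm_add_sq ℂ, inner_smul_right, norm_smul]
  simp [mul_pow]
  ring

end WeakDerivatives

/-! ### The radial Helmholtz equation on the half-line -/

section RadialODE

variable {n : ℕ} {U V F : ℝ → ℂ}

theorem hasDerivAt_pow_div {r : ℝ} (hr : 0 < r) (n : ℕ) :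
    HasDerivAt (fun s : ℝ => s ^ n) (n * r ^ n / r) r := by
  have := hasDerivAt_pow n r
  rcases n with _ | n
  · simpa using this
  · refine this.congr_deriv ?_
    rw [pow_succ, ← mul_assoc, mul_div_assoc, div_self hr.ne', mul_one, Nat.add_sub_cancel]

/-- The energy `r^n (|V|² + |U|²)`, where `V = U'`, of a radial function, corrected by the term
`n r^(n-1) ⟪U, V⟫` so that its derivative contains no terms of the size of the energy divided
by `r`. -/
def energy (n : ℕ) (U V : ℝ → ℂ) (r : ℝ) : ℝ :=
  r ^ n * (‖V r‖ ^ 2 + ‖U r‖ ^ 2 + n / r * inner ℝ (U r) (V r))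

theorem hasDerivAt_energy {r : ℝ} (hr : 0 < r) (hU : HasDerivAt U (V r) r)
    (hV : HasDerivAt V (F r - U r - (n / r : ℝ) • V r) r) :
    HasDerivAt (energy n U V) (r ^ n * (2 * inner ℝ (V r) (F r) + n / r * inner ℝ (U r) (F r)
      - n / r ^ 2 * inner ℝ (U r) (V r))) r := by
  have h1 := (((hV.norm_sq).add hU.norm_sq).add
    (((hasDerivAt_const r (n : ℝ)).div (hasDerivAt_id r) hr.ne').mul (hU.inner ℝ hV)))
  have h2 := (hasDerivAt_pow_div hr n).mul h1
  refine h2.congr_deriv ?_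
  simp only [inner_sub_right, inner_smul_right, real_inner_self_eq_norm_sq, Pi.add_apply,
    Pi.mul_apply, Pi.div_apply, id, real_inner_comm (V r) (U r)]
  field_simp
  ring

/-- The derivative of `r` times the energy, in a form that makes sense at `r = 0`. Its leading term
is the uncorrected energy. -/
theorem hasDerivAt_mul_energy {r : ℝ} (hr : 0 < r) (hU : HasDerivAt U (V r) r)
    (hV : HasDerivAt V (F r - U r - (n / r : ℝ) • V r) r) :
    HasDerivAt (fun r => r ^ n * (r * (‖V r‖ ^ 2 + ‖U r‖ ^ 2) + n * inner ℝ (U r) (V r)))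
      (r ^ n * (‖U r‖ ^ 2 + ‖V r‖ ^ 2) + r ^ n * (2 * r * inner ℝ (V r) (F r)
        + n * inner ℝ (U r) (F r))) r := by
  have h1 := (((hasDerivAt_id r).mul ((hV.norm_sq).add hU.norm_sq)).add
    ((hU.inner ℝ hV).const_mul (n : ℝ)))
  have h2 := (hasDerivAt_pow_div hr n).mul h1
  refine h2.congr_deriv ?_
  simp only [inner_sub_right, inner_smul_right, real_inner_self_eq_norm_sq, Pi.add_apply,
    Pi.mul_apply, id, real_inner_comm (V r) (U r)]
  field_simp
  ring

theorem abs_inner_le_half (z w : ℂ) : |inner ℝ z w| ≤ (‖z‖ ^ 2 + ‖w‖ ^ 2) / 2 := by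
  have := abs_real_inner_le_norm z w
  nlinarith [sq_nonneg (‖z‖ - ‖w‖)]

theorem energy_bounds {r : ℝ} (hr : 0 < r) (hnr : n ≤ r) :
    r ^ n * (‖U r‖ ^ 2 + ‖V r‖ ^ 2) / 2 ≤ energy n U V r ∧
      energy n U V r ≤ 2 * (r ^ n * (‖U r‖ ^ 2 + ‖V r‖ ^ 2)) := by
  have h0 : (n : ℝ) / r ≤ 1 := by rw [div_le_one hr]; exact hnr
  have h0' : 0 ≤ (n : ℝ) / r := by positivity
  have h1 := abs_inner_le_half (U r) (V r)
  have h2 : |(n : ℝ) / r * inner ℝ (U r) (V r)| ≤ (‖U r‖ ^ 2 + ‖V r‖ ^ 2) / 2 := by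
    rw [abs_mul, abs_of_nonneg h0']
    nlinarith [abs_nonneg (inner ℝ (U r) (V r))]
  have h3 := abs_le.mp h2
  have h4 : 0 < r ^ n := by positivity
  unfold energy
  constructor
  · rw [mul_div_assoc]
    apply mul_le_mul_of_nonneg_left _ h4.le
    linarith [h3.1]
  · rw [mul_left_comm]
    apply mul_le_mul_of_nonneg_left _ h4.le
    nlinarith [h3.2, sq_nonneg ‖U r‖, sq_nonneg ‖V r‖]

/-- An integrable function on `(0, ∞)` is small at arbitrarily large points. -/
theorem exists_large_small {g : ℝ → ℝ} (hg : IntegrableOn g (Set.Ioi 0)) (R : ℝ) {η : ℝ}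
    (hη : 0 < η) : ∃ s, R < s ∧ g s ≤ η := by
  by_contra! h
  have h1 : IntegrableOn (fun _ : ℝ => η) (Set.Ioi (max R 0)) := by
    refine Integrable.mono' (hg.mono_set (Set.Ioi_subset_Ioi (le_max_right _ _))) (by fun_prop) ?_
    refine (ae_restrict_iff' measurableSet_Ioi).mpr (Eventually.of_forall fun s hs => ?_)
    rw [Real.norm_of_nonneg hη.le]
    exact (h s (lt_of_le_of_lt (le_max_left _ _) hs)).le
  rw [integrableOn_const_iff (by simp)] at h1
  simp [hη.ne'] at h1

/-- Far from the origin the energy is bounded pointwise: it tends to `0` along a sequence of radii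
because it is integrable, and its derivative is controlled by the forcing term `F`. -/
theorem energy_pointwise (hn : 1 ≤ n) (hU : ∀ r, 0 < r → HasDerivAt U (V r) r)
    (hV : ∀ r, 0 < r → HasDerivAt V (F r - U r - (n / r : ℝ) • V r) r)
    (hP : IntegrableOn (fun r => r ^ n * (‖U r‖ ^ 2 + ‖V r‖ ^ 2)) (Set.Ioi 0))
    (hA : IntegrableOn (fun r => r ^ n * (‖F r‖ * (‖U r‖ + ‖V r‖))) (Set.Ioi 0))
    {r : ℝ} (hr : n ≤ r) :
    r ^ n * (‖U r‖ ^ 2 + ‖V r‖ ^ 2) ≤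
      12 * ∫ r in Set.Ioi 0, r ^ n * (‖F r‖ * (‖U r‖ + ‖V r‖)) := by
  set S := ∫ r in Set.Ioi 0, r ^ n * (‖F r‖ * (‖U r‖ + ‖V r‖))
  have hn' : (1 : ℝ) ≤ n := by exact_mod_cast hn
  have hr0 : 0 < r := by linarith
  -- the integrating factor `exp (-n/t)` absorbs the term `n / t² ⟪U, V⟫` of the derivative
  have key : ∀ s, r < s → Real.exp (-(n / r)) * energy n U V r ≤
      energy n U V s + 2 * S := by
    intro s hs
    set g : ℝ → ℝ := fun t => -(Real.exp (-(n / t)) * energy n U V t)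
    have hd : ∀ t, 0 < t → HasDerivAt g (-(Real.exp (-(n / t)) * (n / t ^ 2) * energy n U V t +
        Real.exp (-(n / t)) * (t ^ n * (2 * inner ℝ (V t) (F t) + n / t * inner ℝ (U t) (F t)
      - n / t ^ 2 * inner ℝ (U t) (V t))))) t := by
      intro t ht
      have h1 := ((((hasDerivAt_const t (n : ℝ)).div (hasDerivAt_id t) ht.ne').neg).exp.mul
        (hasDerivAt_energy ht (hU t ht) (hV t ht))).neg
      refine h1.congr_deriv ?_
      simp
      field_simp
    have h2 := intervalIntegral.sub_le_integral_of_hasDeriv_right_of_le (a := r) (b := s) (g := g)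
      (φ := fun r => 2 * (r ^ n * (‖F r‖ * (‖U r‖ + ‖V r‖)))) hs.le
      (fun t ht => (hd t (hr0.trans_le ht.1)).continuousAt.continuousWithinAt)
      (fun t ht => (hd t (hr0.trans ht.1)).hasDerivWithinAt)
      ((hA.mono_set fun t ht => hr0.trans_le ht.1).const_mul 2) (by
        intro t ht
        have ht0 : 0 < t := hr0.trans ht.1
        have hnt : (n : ℝ) ≤ t := hr.trans ht.1.le
        have e1 : Real.exp (-(n / t)) ≤ 1 := Real.exp_le_one_iff.mpr (by
          have : 0 ≤ (n : ℝ) / t := by positivity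
          linarith)
        have e0 := Real.exp_pos (-(n / t))
        have b1 := (energy_bounds (n := n) (U := U) (V := V) ht0 hnt).1
        have b2 := abs_le.mp (abs_inner_le_half (U t) (V t))
        have b3 := abs_le.mp (abs_real_inner_le_norm (V t) (F t))
        have b4 := abs_le.mp (abs_real_inner_le_norm (U t) (F t))
        have q0 : (n : ℝ) / t ≤ 1 := by rw [div_le_one ht0]; exact hnt
        have q0' : 0 ≤ (n : ℝ) / t := by positivity
        have p0 : 0 < t ^ n := by positivity
        have q2 : 0 ≤ (n : ℝ) / t ^ 2 := by positivity
        have c1 : -(2 * (t ^ n * (‖F t‖ * (‖U t‖ + ‖V t‖)))) ≤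
            n / t ^ 2 * energy n U V t + t ^ n * (2 * inner ℝ (V t) (F t)
              + n / t * inner ℝ (U t) (F t) - n / t ^ 2 * inner ℝ (U t) (V t)) := by
          have d1 : n / t ^ 2 * (t ^ n * (‖U t‖ ^ 2 + ‖V t‖ ^ 2) / 2) ≤
            n / t ^ 2 * energy n U V t := mul_le_mul_of_nonneg_left b1 q2
          have d2 : n / t ^ 2 * inner ℝ (U t) (V t) ≤
            n / t ^ 2 * ((‖U t‖ ^ 2 + ‖V t‖ ^ 2) / 2) := mul_le_mul_of_nonneg_left b2.2 q2
          have d3 : -(‖U t‖ * ‖F t‖) ≤ n / t * inner ℝ (U t) (F t) := by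
            have : -(‖U t‖ * ‖F t‖) * 1 ≤ n / t * -(‖U t‖ * ‖F t‖) := by
              nlinarith [mul_nonneg (norm_nonneg (U t)) (norm_nonneg (F t))]
            nlinarith [mul_le_mul_of_nonneg_left b4.1 q0']
          have d4 : 0 ≤ ‖U t‖ * ‖F t‖ := by positivity
          have d5 : t ^ n * (-(2 * (‖F t‖ * (‖U t‖ + ‖V t‖))) -
              n / t ^ 2 * ((‖U t‖ ^ 2 + ‖V t‖ ^ 2) / 2)) ≤ t ^ n * (2 * inner ℝ (V t) (F t)
              + n / t * inner ℝ (U t) (F t) - n / t ^ 2 * inner ℝ (U t) (V t)) := by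
            apply mul_le_mul_of_nonneg_left _ p0.le
            nlinarith [b3.1]
          nlinarith
        have a0 : 0 ≤ 2 * (t ^ n * (‖F t‖ * (‖U t‖ + ‖V t‖))) := by positivity
        nlinarith [mul_le_mul_of_nonneg_left c1 e0.le])
    have h3 : ∫ y in r..s, 2 * (y ^ n * (‖F y‖ * (‖U y‖ + ‖V y‖))) ≤ 2 * S := by
      rw [intervalIntegral.integral_const_mul, intervalIntegral.integral_of_le hs.le]
      apply mul_le_mul_of_nonneg_left _ (by norm_num)
      apply setIntegral_mono_set hA
      · refine (ae_restrict_iff' measurableSet_Ioi).mpr (Eventually.of_forall fun t ht => ?_)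
        have : (0 : ℝ) < t := ht
        simp only [Pi.zero_apply]
        positivity
      · exact Eventually.of_forall fun t ht => hr0.trans ht.1
    have h4 : Real.exp (-(n / s)) * energy n U V s ≤ energy n U V s := by
      have hs0 : 0 < s := hr0.trans hs
      have := (energy_bounds (n := n) (U := U) (V := V) hs0 (hr.trans hs.le)).1
      have h5 : 0 ≤ energy n U V s := le_trans (by positivity) this
      have e1 : Real.exp (-(n / s)) ≤ 1 := Real.exp_le_one_iff.mpr (by
          have : 0 ≤ (n : ℝ) / s := by positivity
          linarith)
      nlinarith
    simp only [g] at h2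
    linarith
  have key2 : Real.exp (-(n / r)) * energy n U V r ≤ 2 * S := by
    apply le_of_forall_pos_le_add
    intro η hη
    obtain ⟨s, hs, hs'⟩ := exists_large_small hP r (η := η / 2) (by positivity)
    have := key s hs
    have h2 := (energy_bounds (n := n) (U := U) (V := V) (hr0.trans hs) (hr.trans hs.le)).2
    linarith
  have e1 : Real.exp (-1) ≤ Real.exp (-(n / r)) := by
    apply Real.exp_le_exp.mpr
    have : (n : ℝ) / r ≤ 1 := by rw [div_le_one hr0]; exact hr
    linarith
  have e2 : 1 / 3 ≤ Real.exp (-1) := by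
    rw [Real.exp_neg, one_div]
    exact inv_anti₀ (Real.exp_pos 1) (by linarith [Real.exp_one_lt_d9])
  have b1 := (energy_bounds (n := n) (U := U) (V := V) hr0 hr).1
  have b0 : 0 ≤ energy n U V r := le_trans (by positivity) b1
  nlinarith

/-- The energy near the origin, from integrating the derivative of `r` times the energy. -/
theorem energy_near_zero (hn : 1 ≤ n) (hUc : Continuous U) (hVc : Continuous V)
    (hU : ∀ r, 0 < r → HasDerivAt U (V r) r)
    (hV : ∀ r, 0 < r → HasDerivAt V (F r - U r - (n / r : ℝ) • V r) r)
    (hP : IntegrableOn (fun r => r ^ n * (‖U r‖ ^ 2 + ‖V r‖ ^ 2)) (Set.Ioi 0))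
    (hA : IntegrableOn (fun r => r ^ n * (‖F r‖ * (‖U r‖ + ‖V r‖))) (Set.Ioi 0)) :
    ∫ r in (0 : ℝ)..n, r ^ n * (‖U r‖ ^ 2 + ‖V r‖ ^ 2) ≤
      27 * n * ∫ r in Set.Ioi 0, r ^ n * (‖F r‖ * (‖U r‖ + ‖V r‖)) := by
  set S := ∫ r in Set.Ioi 0, r ^ n * (‖F r‖ * (‖U r‖ + ‖V r‖)) with hS
  have hn' : (1 : ℝ) ≤ n := by exact_mod_cast hn
  have hn0 : (0 : ℝ) ≤ n := by linarith
  set D : ℝ → ℝ := fun r => r ^ n * (r * (‖V r‖ ^ 2 + ‖U r‖ ^ 2) + n * inner ℝ (U r) (V r))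
  have hIcc : ∀ {f : ℝ → ℝ}, IntegrableOn f (Set.Ioi 0) → IntegrableOn f (Set.Icc 0 (n : ℝ)) := by
    intro f hf
    rw [integrableOn_Icc_iff_integrableOn_Ioc]
    exact hf.mono_set fun t ht => ht.1
  have h2 := intervalIntegral.sub_le_integral_of_hasDeriv_right_of_le (a := 0) (b := n)
      (g := fun r => - D r)
      (φ := fun r => 3 * n * (r ^ n * (‖F r‖ * (‖U r‖ + ‖V r‖))) -
        r ^ n * (‖U r‖ ^ 2 + ‖V r‖ ^ 2)) hn0
      (by
        have : Continuous fun r => - D r := by fun_prop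
        exact this.continuousOn)
      (fun t ht => ((hasDerivAt_mul_energy ht.1 (hU t ht.1) (hV t ht.1)).neg).hasDerivWithinAt)
      ((((hIcc hA).const_mul (3 * n : ℝ)).sub (hIcc hP)).congr
        (Eventually.of_forall fun _ => rfl)) (by
        intro t ht
        have ht0 : 0 < t := ht.1
        have b3 := abs_le.mp (abs_real_inner_le_norm (V t) (F t))
        have b4 := abs_le.mp (abs_real_inner_le_norm (U t) (F t))
        have p0 : 0 < t ^ n := by positivity
        have c1 : -(2 * t * inner ℝ (V t) (F t) + n * inner ℝ (U t) (F t)) ≤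
            3 * n * (‖F t‖ * (‖U t‖ + ‖V t‖)) := by
          have d1 : t * (-(inner ℝ (V t) (F t))) ≤ n * (‖V t‖ * ‖F t‖) := by
            have := mul_le_mul_of_nonneg_left (show -(inner ℝ (V t) (F t)) ≤ ‖V t‖ * ‖F t‖ by
              linarith [b3.1]) ht0.le
            have h5 : t * (‖V t‖ * ‖F t‖) ≤ n * (‖V t‖ * ‖F t‖) :=
              mul_le_mul_of_nonneg_right ht.2.le (by positivity)
            linarith
          have d2 : n * (-(inner ℝ (U t) (F t))) ≤ n * (‖U t‖ * ‖F t‖) :=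
            mul_le_mul_of_nonneg_left (by linarith [b4.1]) hn0
          have d3 : 0 ≤ n * (‖U t‖ * ‖F t‖) := by positivity
          have d4 : 0 ≤ n * (‖V t‖ * ‖F t‖) := by positivity
          nlinarith
        nlinarith [mul_le_mul_of_nonneg_left c1 p0.le])
  have h3 : D 0 = 0 := by simp [D, show n ≠ 0 by omega]
  have h4 : D n ≤ 24 * n * S := by
    have e1 : D n = n * energy n U V n := by
      simp only [D, energy]
      field_simp
    have e2 := (energy_bounds (n := n) (U := U) (V := V) (r := n) (by linarith) le_rfl).2
    have e3 := energy_pointwise hn hU hV hP hA (r := n) le_rfl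
    rw [e1]
    nlinarith
  have hi1 : IntervalIntegrable (fun r => r ^ n * (‖F r‖ * (‖U r‖ + ‖V r‖))) volume 0 n := by
    rw [intervalIntegrable_iff_integrableOn_Icc_of_le hn0]; exact hIcc hA
  have hi2 : IntervalIntegrable (fun r => r ^ n * (‖U r‖ ^ 2 + ‖V r‖ ^ 2)) volume 0 n := by
    rw [intervalIntegrable_iff_integrableOn_Icc_of_le hn0]; exact hIcc hP
  rw [intervalIntegral.integral_sub (hi1.const_mul _) hi2,
    intervalIntegral.integral_const_mul] at h2
  have h5 : ∫ y in (0 : ℝ)..n, y ^ n * (‖F y‖ * (‖U y‖ + ‖V y‖)) ≤ S := by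
    rw [intervalIntegral.integral_of_le hn0]
    apply setIntegral_mono_set hA
    · refine (ae_restrict_iff' measurableSet_Ioi).mpr (Eventually.of_forall fun t ht => ?_)
      have : (0 : ℝ) < t := ht
      simp only [Pi.zero_apply]
      positivity
    · exact Eventually.of_forall fun t ht => ht.1
  have h6 := mul_le_mul_of_nonneg_left h5 (show (0 : ℝ) ≤ 3 * n by positivity)
  simp only [h3] at h2
  linarith

/-- The exponent of the blow-up at the origin that `radial_ode_bound` allows. It equals
`(n + 1) / 2_*` with `2_* = 2 (n + 2) / n`, so that `r ^ (-p * nearExp n)` is integrable at the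
origin of `ℝ^(n+1)` for `p < 2_*`. It exceeds `(n - 1) / 2`, which leaves room for the integrable weight
`s ^ (η - 1)` in the Cauchy–Schwarz inequality. -/
def nearExp (n : ℕ) : ℝ := n * (n + 1) / (2 * (n + 2))

/-- Pointwise bounds for the solution `U` of `U'' + (n/r) U' + U = F` in terms of the weighted
integral of `|F| (|U| + |U'|)`: the energy estimate gives the decay, and near the origin `U` is
recovered by integrating `U'` inwards from `r = n`. -/
theorem radial_ode_bound (n : ℕ) (hn : 1 ≤ n) : ∃ C : ℝ, 0 < C ∧ ∀ (U V F : ℝ → ℂ) (M : ℝ), 0 < M →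
    Continuous U → Continuous V → (∀ r, 0 < r → HasDerivAt U (V r) r) →
    (∀ r, 0 < r → HasDerivAt V (F r - U r - (n / r : ℝ) • V r) r) →
    IntegrableOn (fun r => r ^ n * (‖U r‖ ^ 2 + ‖V r‖ ^ 2)) (Set.Ioi 0) →
    IntegrableOn (fun r => r ^ n * (‖F r‖ * (‖U r‖ + ‖V r‖))) (Set.Ioi 0) →
    ∫ r in Set.Ioi 0, r ^ n * (‖F r‖ * (‖U r‖ + ‖V r‖)) ≤ M ^ 2 →
    (∀ r : ℝ, n ≤ r → ‖U r‖ ≤ C * M * r ^ (-(n / 2 : ℝ))) ∧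
    (∀ r : ℝ, 0 < r → r ≤ n → ‖U r‖ ≤ C * M * r ^ (-nearExp n)) := by
  have hn' : (1 : ℝ) ≤ n := by exact_mod_cast hn
  have hn0 : (0 : ℝ) < n := by linarith
  set σ := nearExp n with hσ
  have hσ0 : 0 ≤ σ := by rw [hσ, nearExp]; positivity
  set η : ℝ := 2 / (n + 2) with hη
  have hη0 : 0 < η := by positivity
  have hση : (n : ℝ) = 2 * σ + (1 - η) := by rw [hσ, hη, nearExp]; field_simp; ring
  set C : ℝ := 4 * (n : ℝ) ^ σ + 27 * n + (n : ℝ) ^ η / η + 4 with hC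
  have hnσ : 0 < (n : ℝ) ^ σ := by positivity
  have hnη : 0 < (n : ℝ) ^ η / η := by positivity
  refine ⟨C, by positivity, ?_⟩
  intro U V F M hM hUc hVc hU hV hP hA hS
  have far : ∀ r : ℝ, n ≤ r → ‖U r‖ ≤ 4 * M * r ^ (-(n / 2 : ℝ)) := by
    intro r hr
    have hr0 : 0 < r := by linarith
    have h1 := energy_pointwise hn hU hV hP hA hr
    have h2 : r ^ n * ‖U r‖ ^ 2 ≤ 12 * M ^ 2 := by
      have : 0 ≤ r ^ n * ‖V r‖ ^ 2 := by positivity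
      linarith
    have h3 : (r ^ (-(n / 2 : ℝ))) ^ 2 * r ^ n = 1 := by
      rw [← Real.rpow_natCast, ← Real.rpow_mul hr0.le, ← Real.rpow_natCast, ← Real.rpow_add hr0]
      simp
    have h4 : 0 < r ^ (-(n / 2 : ℝ)) := by positivity
    apply le_of_sq_le_sq _ (by positivity)
    calc ‖U r‖ ^ 2 = (r ^ (-(n / 2 : ℝ))) ^ 2 * (r ^ n * ‖U r‖ ^ 2) := by
          rw [← mul_assoc, h3, one_mul]
      _ ≤ (r ^ (-(n / 2 : ℝ))) ^ 2 * (12 * M ^ 2) := by gcongr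
      _ ≤ _ := by nlinarith [mul_pos (sq_pos_of_pos h4) (sq_pos_of_pos hM)]
  refine ⟨fun r hr => (far r hr).trans ?_, ?_⟩
  · have hr0 : 0 < r := by linarith
    gcongr
    rw [hC]
    linarith [mul_pos hn0 hn0]
  intro r hr0 hr
  have h1 : ‖U n‖ ≤ 4 * M := by
    refine (far n le_rfl).trans ?_
    have : (n : ℝ) ^ (-(n / 2 : ℝ)) ≤ 1 :=
      Real.rpow_le_one_of_one_le_of_nonpos hn' (by simp; positivity)
    nlinarith
  have hrσ : 0 < r ^ (-σ) := by positivity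
  have h2 : 1 ≤ (n : ℝ) ^ σ * r ^ (-σ) := by
    rw [Real.rpow_neg hr0.le, ← div_eq_mul_inv, ← Real.div_rpow hn0.le hr0.le]
    exact Real.one_le_rpow (by rw [le_div_iff₀ hr0]; linarith) hσ0
  -- the weighted energy and the dual weight are balanced by the factor `t`
  set t : ℝ := r ^ (-σ) / M with ht
  have ht0 : 0 < t := by positivity
  have h3 : ‖U n - U r‖ ≤ ∫ s in r..n, (t * (s ^ n * (‖U s‖ ^ 2 + ‖V s‖ ^ 2)) +
      t⁻¹ * (r ^ (-(2 * σ)) * s ^ (η - 1))) := by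
    rw [← intervalIntegral.integral_eq_sub_of_hasDerivAt (f' := V)
      (fun s hs => hU s (by rw [Set.uIcc_of_le hr] at hs; linarith [hs.1]))
      (hVc.intervalIntegrable _ _)]
    refine (intervalIntegral.norm_integral_le_integral_norm hr).trans ?_
    apply intervalIntegral.integral_mono_on hr (hVc.norm.intervalIntegrable _ _)
    · apply IntervalIntegrable.add
      · apply Continuous.intervalIntegrable; fun_prop
      · apply ContinuousOn.intervalIntegrable
        rw [Set.uIcc_of_le hr]
        intro s hs
        have : s ≠ 0 := by linarith [hs.1]
        apply ContinuousAt.continuousWithinAt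
        fun_prop (disch := simp [this])
    · intro s hs
      have hs0 : 0 < s := by linarith [hs.1]
      have e1 : s ^ (-(2 * σ)) ≤ r ^ (-(2 * σ)) :=
        Real.rpow_le_rpow_of_nonpos hr0 hs.1 (by linarith)
      have e2 : s ^ n * (s ^ (-(2 * σ)) * s ^ (η - 1)) = 1 := by
        rw [← Real.rpow_natCast, ← Real.rpow_add hs0, ← Real.rpow_add hs0]
        rw [show (n : ℝ) + (-(2 * σ) + (η - 1)) = 0 by linarith, Real.rpow_zero]
      set w := s ^ (-(2 * σ)) * s ^ (η - 1) with hw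
      have hw0 : 0 < w := by positivity
      have e3 : w ≤ r ^ (-(2 * σ)) * s ^ (η - 1) := by rw [hw]; gcongr
      have e4 : t⁻¹ * w ≤ t⁻¹ * (r ^ (-(2 * σ)) * s ^ (η - 1)) := by gcongr
      have e5 : t * (s ^ n * ‖V s‖ ^ 2) ≤ t * (s ^ n * (‖U s‖ ^ 2 + ‖V s‖ ^ 2)) := by
        gcongr; nlinarith [sq_nonneg ‖U s‖]
      have e6 : ‖V s‖ ≤ t * (s ^ n * ‖V s‖ ^ 2) + t⁻¹ * w := by
        have a1 : s ^ n = w⁻¹ := eq_inv_of_mul_eq_one_left e2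
        rw [a1]
        have a2 : t * (w⁻¹ * ‖V s‖ ^ 2) + t⁻¹ * w - ‖V s‖ =
          ((t * ‖V s‖ - w / 2) ^ 2 + 3 / 4 * w ^ 2) / (t * w) := by field_simp; ring
        have a3 : 0 ≤ ((t * ‖V s‖ - w / 2) ^ 2 + 3 / 4 * w ^ 2) / (t * w) := by positivity
        linarith
      linarith
  have hi : IntervalIntegrable (fun s => s ^ (η - 1)) volume r n := by
    apply intervalIntegral.intervalIntegrable_rpow' (by linarith)
  rw [intervalIntegral.integral_add, intervalIntegral.integral_const_mul,
    intervalIntegral.integral_const_mul, intervalIntegral.integral_const_mul] at h3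
  rotate_left
  · apply Continuous.intervalIntegrable; fun_prop
  · exact (hi.const_mul _).const_mul _
  have h4 : ∫ s in r..n, s ^ n * (‖U s‖ ^ 2 + ‖V s‖ ^ 2) ≤ 27 * n * M ^ 2 := by
    have a1 := energy_near_zero hn hUc hVc hU hV hP hA
    have a2 : ∫ s in r..n, s ^ n * (‖U s‖ ^ 2 + ‖V s‖ ^ 2) ≤
        ∫ s in (0 : ℝ)..n, s ^ n * (‖U s‖ ^ 2 + ‖V s‖ ^ 2) := by
      apply intervalIntegral.integral_mono_interval hr0.le hr le_rfl
      · refine (ae_restrict_iff' measurableSet_Ioc).mpr (Eventually.of_forall fun s hs => ?_)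
        have : (0 : ℝ) < s := hs.1
        simp only [Pi.zero_apply]
        positivity
      · apply Continuous.intervalIntegrable; fun_prop
    have a3 := mul_le_mul_of_nonneg_left hS (show (0 : ℝ) ≤ 27 * n by positivity)
    linarith
  have h5 : ∫ s in r..n, s ^ (η - 1) ≤ (n : ℝ) ^ η / η := by
    rw [integral_rpow (Or.inl (by linarith))]
    rw [sub_add_cancel]
    gcongr
    have : 0 < r ^ η := by positivity
    linarith
  have h6 : r ^ (-(2 * σ)) = r ^ (-σ) * r ^ (-σ) := by
    rw [← Real.rpow_add hr0]; ring_nf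
  have h7 : t * (27 * n * M ^ 2) = 27 * n * (M * r ^ (-σ)) := by rw [ht]; field_simp
  have h8 : t⁻¹ * (r ^ (-(2 * σ)) * ((n : ℝ) ^ η / η)) = (n : ℝ) ^ η / η * (M * r ^ (-σ)) := by
    rw [ht, h6]; field_simp
  have h9 := mul_le_mul_of_nonneg_left h4 ht0.le
  have h10 : t⁻¹ * (r ^ (-(2 * σ)) * ∫ s in r..n, s ^ (η - 1)) ≤
    t⁻¹ * (r ^ (-(2 * σ)) * ((n : ℝ) ^ η / η)) := by gcongr
  have h11 : ‖U r‖ ≤ ‖U n‖ + ‖U n - U r‖ := by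
    have := norm_sub_le (U n) (U n - U r)
    simpa using this
  have h12 : 4 * M ≤ 4 * (n : ℝ) ^ σ * (M * r ^ (-σ)) := by nlinarith
  have h13 : 0 < M * r ^ (-σ) := by positivity
  have h14 : C * M * r ^ (-σ) = 4 * (n : ℝ) ^ σ * (M * r ^ (-σ)) + 27 * n * (M * r ^ (-σ)) +
    (n : ℝ) ^ η / η * (M * r ^ (-σ)) + 4 * (M * r ^ (-σ)) := by rw [hC]; ring
  linarith

end RadialODE

/-! ### Smooth radial functions -/

section RadialFunctions

variable {n : ℕ} {u : E (n + 1) → ℂ}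

/-- The profile `r ↦ u (r e₀)` of a function on `ℝ^(n+1)`, for all real `r`, so that the profile of
a smooth radial function is smooth across `r = 0`. -/
def profile (u : E (n + 1) → ℂ) (r : ℝ) : ℂ := u (r • EuclideanSpace.single 0 1)

theorem apply_smul_eq_profile (hrad : ∀ x y, ‖x‖ = ‖y‖ → u x = u y) {e : E (n + 1)} (he : ‖e‖ = 1)
    (r : ℝ) : u (r • e) = profile u r :=
  hrad _ _ (by simp [norm_smul, he])

theorem apply_eq_profile_norm (hrad : ∀ x y, ‖x‖ = ‖y‖ → u x = u y) (x : E (n + 1)) :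
    u x = profile u ‖x‖ :=
  hrad _ _ (by simp [norm_smul])

theorem contDiff_profile {k : WithTop ℕ∞} (hu : ContDiff ℝ k u) : ContDiff ℝ k (profile u) :=
  hu.comp (contDiff_id.smul contDiff_const)

theorem hasDerivAt_line (x v : E (n + 1)) (t : ℝ) : HasDerivAt (fun s : ℝ => x + s • v) v t := by
  simpa using ((hasDerivAt_id t).smul_const v).const_add x

theorem hasDerivAt_comp_line (hu : Differentiable ℝ u) (x v : E (n + 1)) (t : ℝ) :
    HasDerivAt (fun s : ℝ => u (x + s • v)) (fderiv ℝ u (x + t • v) v) t :=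
  ((hu _).hasFDerivAt).comp_hasDerivAt t (hasDerivAt_line x v t)

theorem hasDerivAt_fderiv_line (hu : ContDiff ℝ 2 u) (x v w : E (n + 1)) (t : ℝ) :
    HasDerivAt (fun s : ℝ => fderiv ℝ u (x + s • v) w)
      (fderiv ℝ (fderiv ℝ u) (x + t • v) v w) t := by
  have h1 : Differentiable ℝ (fderiv ℝ u) :=
    (hu.fderiv_right (m := 1) (by norm_num)).differentiable (by norm_num)
  have h2 := ((h1 _).hasFDerivAt).comp_hasDerivAt t (hasDerivAt_line x v t)
  exact ((ContinuousLinearMap.apply ℝ ℂ w).hasFDerivAt).comp_hasDerivAt t h2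

theorem deriv_profile (hu : ContDiff ℝ 2 u) (hrad : ∀ x y, ‖x‖ = ‖y‖ → u x = u y) {e : E (n + 1)}
    (he : ‖e‖ = 1) (r : ℝ) : deriv (profile u) r = fderiv ℝ u (r • e) e := by
  have h := hasDerivAt_comp_line (hu.differentiable (by norm_num)) 0 e r
  simp only [zero_add, apply_smul_eq_profile hrad he] at h
  exact h.deriv

theorem deriv_deriv_profile (hu : ContDiff ℝ 2 u) (hrad : ∀ x y, ‖x‖ = ‖y‖ → u x = u y)
    {e : E (n + 1)} (he : ‖e‖ = 1) (r : ℝ) :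
    deriv (deriv (profile u)) r = fderiv ℝ (fderiv ℝ u) (r • e) e e := by
  have h := hasDerivAt_fderiv_line hu 0 e e r
  simp only [zero_add, ← deriv_profile hu hrad he] at h
  exact h.deriv

theorem hasDerivAt_profile (hu : ContDiff ℝ 2 u) (r : ℝ) :
    HasDerivAt (profile u) (deriv (profile u) r) r :=
  (((contDiff_profile hu).differentiable (by norm_num)) r).hasDerivAt

theorem contDiff_deriv_profile (hu : ContDiff ℝ 2 u) : ContDiff ℝ 1 (deriv (profile u)) :=
  ((contDiff_succ_iff_deriv (n := 1)).mp (by exact_mod_cast contDiff_profile hu)).2.2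

theorem hasDerivAt_deriv_profile (hu : ContDiff ℝ 2 u) (r : ℝ) :
    HasDerivAt (deriv (profile u)) (deriv (deriv (profile u)) r) r :=
  (((contDiff_deriv_profile hu).differentiable (by norm_num)) r).hasDerivAt

theorem hasDerivAt_smul_self {g : ℝ → ℂ} (hg : ContinuousAt g 0) :
    HasDerivAt (fun t => t • g t) (g 0) 0 := by
  rw [hasDerivAt_iff_tendsto_slope]
  refine (hg.tendsto.mono_left nhdsWithin_le_nhds).congr' ?_
  filter_upwards [self_mem_nhdsWithin] with t ht
  have : t ≠ 0 := ht
  simp [slope_def_module, this]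

/-- A radial function has second derivative `U'(r) / r` in tangential directions. -/
theorem fderiv_fderiv_tangential (hu : ContDiff ℝ 2 u) (hrad : ∀ x y, ‖x‖ = ‖y‖ → u x = u y)
    {x v : E (n + 1)} (hx : x ≠ 0) (hv : ‖v‖ = 1) (hxv : inner ℝ x v = 0) :
    fderiv ℝ (fderiv ℝ u) x v v = ‖x‖⁻¹ • deriv (profile u) ‖x‖ := by
  have hx0 : 0 < ‖x‖ := norm_pos_iff.mpr hx
  have hnorm : ∀ t : ℝ, ‖x + t • v‖ = Real.sqrt (‖x‖ ^ 2 + t ^ 2) := by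
    intro t
    rw [eq_comm, Real.sqrt_eq_iff_eq_sq (by positivity) (by positivity), @norm_add_sq_real,
      inner_smul_right, hxv, norm_smul, hv]
    simp
  have hpos : ∀ t : ℝ, 0 < ‖x‖ ^ 2 + t ^ 2 := fun t => by positivity
  set ρ : ℝ → ℝ := fun t => Real.sqrt (‖x‖ ^ 2 + t ^ 2) with hρ
  have hρd : ∀ t, HasDerivAt ρ (t / ρ t) t := by
    intro t
    have := (((hasDerivAt_id t).pow 2).const_add (‖x‖ ^ 2)).sqrt (hpos t).ne'
    refine this.congr_deriv ?_
    simp [hρ]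
    field_simp
  have hρ0 : ∀ t, ρ t ≠ 0 := fun t => (Real.sqrt_pos.mpr (hpos t)).ne'
  have hρz : ρ 0 = ‖x‖ := by simp [hρ]
  have h1 : ∀ t : ℝ, fderiv ℝ u (x + t • v) v = t • ((ρ t)⁻¹ • deriv (profile u) (ρ t)) := by
    intro t
    have h2 := hasDerivAt_comp_line (hu.differentiable (by norm_num)) x v t
    have h3 : (fun s : ℝ => u (x + s • v)) = profile u ∘ ρ := by
      ext s
      rw [apply_eq_profile_norm hrad, hnorm]; rfl
    rw [h3] at h2
    rw [← h2.deriv]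
    have h4 := (hasDerivAt_profile hu (ρ t)).scomp t (hρd t)
    rw [h4.deriv, div_eq_mul_inv, mul_smul]
  have h2 := hasDerivAt_fderiv_line hu x v v 0
  simp only [h1, zero_smul, add_zero] at h2
  have hcont : ContinuousAt (fun t => (ρ t)⁻¹ • deriv (profile u) (ρ t)) 0 := by
    have c1 : ContinuousAt ρ 0 := (hρd 0).continuousAt
    exact (c1.inv₀ (hρ0 0)).smul
      ((contDiff_deriv_profile hu).continuous.continuousAt.comp c1)
  have h3 := hasDerivAt_smul_self hcont
  rw [h2.unique h3, hρz]

/-- Every point lies on the first axis of some orthonormal basis. -/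
theorem exists_basis_axis {x : E (n + 1)} (hx : x ≠ 0) :
    ∃ b : OrthonormalBasis (Fin (n + 1)) ℝ (E (n + 1)), x = ‖x‖ • b 0 := by
  have hx0 : 0 < ‖x‖ := norm_pos_iff.mpr hx
  have h1 : ‖(EuclideanSpace.single 0 1 : E (n + 1))‖ = ‖‖x‖⁻¹ • x‖ := by
    simp [norm_smul, hx0.ne']
  refine ⟨(EuclideanSpace.basisFun (Fin (n + 1)) ℝ).map
    (ℝ ∙ ((EuclideanSpace.single 0 1 : E (n + 1)) - ‖x‖⁻¹ • x))ᗮ.reflection, ?_⟩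
  rw [OrthonormalBasis.map_apply, EuclideanSpace.basisFun_apply, Submodule.reflection_sub h1,
    smul_inv_smul₀ hx0.ne']

/-- The Laplacian of a radial function in polar coordinates. -/
theorem laplacian_radial (hu : ContDiff ℝ 2 u) (hrad : ∀ x y, ‖x‖ = ‖y‖ → u x = u y)
    {x : E (n + 1)} (hx : x ≠ 0) :
    (Δ u) x = deriv (deriv (profile u)) ‖x‖ + (n / ‖x‖ : ℝ) • deriv (profile u) ‖x‖ := by
  have hx0 : 0 < ‖x‖ := norm_pos_iff.mpr hx
  obtain ⟨b, hb⟩ := exists_basis_axis hx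
  rw [InnerProductSpace.laplacian_eq_iteratedFDeriv_orthonormalBasis u b]
  simp only [iteratedFDeriv_two_apply, Matrix.cons_val_zero, Matrix.cons_val_one]
  rw [Fin.sum_univ_succ]
  congr 1
  · rw [deriv_deriv_profile hu hrad (b.norm_eq_one 0), ← hb]
  · have h1 : ∀ i : Fin n, fderiv ℝ (fderiv ℝ u) x (b i.succ) (b i.succ) =
        ‖x‖⁻¹ • deriv (profile u) ‖x‖ := by
      intro i
      apply fderiv_fderiv_tangential hu hrad hx (b.norm_eq_one _)
      rw [hb, inner_smul_left, b.inner_eq_zero (Fin.succ_ne_zero i).symm, mul_zero]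
    rw [Finset.sum_congr rfl fun i _ => h1 i]
    simp [div_eq_mul_inv, mul_assoc]

theorem norm_deriv_profile_sq_le (hu : ContDiff ℝ 2 u) (hrad : ∀ x y, ‖x‖ = ‖y‖ → u x = u y)
    {x : E (n + 1)} (hx : x ≠ 0) :
    ‖deriv (profile u) ‖x‖‖ ^ 2 ≤ ∑ i, ‖fderiv ℝ u x (EuclideanSpace.single i 1)‖ ^ 2 := by
  have hx0 : 0 < ‖x‖ := norm_pos_iff.mpr hx
  set e : E (n + 1) := ‖x‖⁻¹ • x with he
  have he1 : ‖e‖ = 1 := by simp [he, norm_smul, hx0.ne']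
  have hxe : ‖x‖ • e = x := smul_inv_smul₀ hx0.ne' x
  rw [deriv_profile hu hrad he1, hxe]
  have h1 : e = ∑ i, e i • (EuclideanSpace.single i 1 : E (n + 1)) := by
    conv_lhs => rw [← (EuclideanSpace.basisFun (Fin (n + 1)) ℝ).sum_repr e]
    simp
  have h2 : fderiv ℝ u x e = ∑ i, e i • fderiv ℝ u x (EuclideanSpace.single i 1) := by
    conv_lhs => rw [h1]
    simp
  have h3 : ‖fderiv ℝ u x e‖ ≤ ∑ i, |e i| * ‖fderiv ℝ u x (EuclideanSpace.single i 1)‖ := by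
    rw [h2]
    refine (norm_sum_le _ _).trans (le_of_eq ?_)
    simp
  have h4 : ∑ i, |e i| ^ 2 = 1 := by
    have := EuclideanSpace.norm_sq_eq e
    rw [he1] at this
    simpa using this.symm
  calc ‖fderiv ℝ u x e‖ ^ 2
      ≤ (∑ i, |e i| * ‖fderiv ℝ u x (EuclideanSpace.single i 1)‖) ^ 2 := by gcongr
    _ ≤ (∑ i, |e i| ^ 2) * ∑ i, ‖fderiv ℝ u x (EuclideanSpace.single i 1)‖ ^ 2 :=
        Finset.sum_mul_sq_le_sq_mul_sq _ _ _
    _ = _ := by rw [h4, one_mul]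

/-- Decay of a radial function `u`, quantified by `Q ≥ ‖Δu + u‖² + δ² ‖u‖²`. The factor
`√(Q / δ)` improves on the factor `√Q / δ` of the radial Sobolev lemma. -/
theorem radial_pointwise_bound (n : ℕ) (hn : 1 ≤ n) : ∃ C : ℝ, 0 < C ∧
    ∀ (u : E (n + 1) → ℂ) (Q δ : ℝ), 0 < Q → 0 < δ → ContDiff ℝ 2 u →
    (∀ x y, ‖x‖ = ‖y‖ → u x = u y) →
    Integrable (fun x => ‖u x‖ ^ 2) → ∫ x, ‖u x‖ ^ 2 ≤ Q / δ ^ 2 →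
    Integrable (fun x => ∑ i, ‖fderiv ℝ u x (EuclideanSpace.single i 1)‖ ^ 2) →
    ∫ x, ∑ i, ‖fderiv ℝ u x (EuclideanSpace.single i 1)‖ ^ 2 ≤ 2 * Q / δ ^ 2 →
    Integrable (fun x => ‖(Δ u) x + u x‖ ^ 2) → ∫ x, ‖(Δ u) x + u x‖ ^ 2 ≤ Q →
    (∀ x, n ≤ ‖x‖ → ‖u x‖ ≤ C * Real.sqrt (Q / δ) * ‖x‖ ^ (-(n / 2 : ℝ))) ∧
    (∀ x, x ≠ 0 → ‖x‖ ≤ n → ‖u x‖ ≤ C * Real.sqrt (Q / δ) * ‖x‖ ^ (-nearExp n)) := by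
  obtain ⟨C, hC, hbound⟩ := radial_ode_bound n hn
  set κ : ℝ := (n + 1) * (volume : Measure (E (n + 1))).real (Metric.ball 0 1) with hκ
  have hκ0 : 0 < κ := by
    have : 0 < (volume : Measure (E (n + 1))).real (Metric.ball 0 1) :=
      ENNReal.toReal_pos (Metric.measure_ball_pos _ _ one_pos).ne' measure_ball_lt_top.ne
    positivity
  refine ⟨C * Real.sqrt (3 / κ), by positivity, ?_⟩
  intro u Q δ hQ hδ hu hrad hi0 hb0 hi1 hb1 hi2 hb2
  set U := profile u with hU
  set V := deriv (profile u) with hV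
  set F : ℝ → ℂ := fun r => deriv V r + (n / r : ℝ) • V r + U r with hF
  have hne : ∀ᵐ x : E (n + 1), x ≠ 0 := by
    simp [ae_iff, measure_singleton]
  have eU : ∀ x, u x = U ‖x‖ := apply_eq_profile_norm hrad
  have eF : ∀ x, x ≠ 0 → (Δ u) x + u x = F ‖x‖ := by
    intro x hx
    rw [laplacian_radial hu hrad hx, eU x]
  have hUc : Continuous U := (contDiff_profile hu).continuous
  have hVc : Continuous V := (contDiff_deriv_profile hu).continuous
  have hWm : Measurable (deriv V) := measurable_deriv _
  have hFm : Measurable F := by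
    have := hUc.measurable
    have := hVc.measurable
    simp only [hF]
    fun_prop
  have iU : Integrable (fun x : E (n + 1) => ‖U ‖x‖‖ ^ 2) := by simpa only [eU] using hi0
  have bU : ∫ x : E (n + 1), ‖U ‖x‖‖ ^ 2 ≤ Q / δ ^ 2 := by simpa only [eU] using hb0
  have leV : ∀ᵐ x : E (n + 1), ‖V ‖x‖‖ ^ 2 ≤
      ∑ i, ‖fderiv ℝ u x (EuclideanSpace.single i 1)‖ ^ 2 := by
    filter_upwards [hne] with x hx using norm_deriv_profile_sq_le hu hrad hx
  have iV : Integrable (fun x : E (n + 1) => ‖V ‖x‖‖ ^ 2) := by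
    refine hi1.mono' (by fun_prop) ?_
    filter_upwards [leV] with x hx
    rwa [Real.norm_of_nonneg (by positivity)]
  have bV : ∫ x : E (n + 1), ‖V ‖x‖‖ ^ 2 ≤ 2 * Q / δ ^ 2 :=
    (integral_mono_ae iV hi1 leV).trans hb1
  have aeF : (fun x => ‖(Δ u) x + u x‖ ^ 2) =ᵐ[volume] fun x => ‖F ‖x‖‖ ^ 2 := by
    filter_upwards [hne] with x hx
    rw [eF x hx]
  have iF : Integrable (fun x : E (n + 1) => ‖F ‖x‖‖ ^ 2) := hi2.congr aeF
  have bF : ∫ x : E (n + 1), ‖F ‖x‖‖ ^ 2 ≤ Q := by rwa [← integral_congr_ae aeF]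
  have iP : Integrable (fun x : E (n + 1) => ‖U ‖x‖‖ ^ 2 + ‖V ‖x‖‖ ^ 2) := iU.add iV
  have bP : ∫ x : E (n + 1), (‖U ‖x‖‖ ^ 2 + ‖V ‖x‖‖ ^ 2) ≤ 3 * Q / δ ^ 2 := by
    rw [integral_add iU iV]
    calc _ ≤ Q / δ ^ 2 + 2 * Q / δ ^ 2 := add_le_add bU bV
      _ = _ := by ring
  -- the weights `δ⁻¹` and `δ` match the bounds `Q` for `F` and `Q / δ²` for `U` and `V`
  have leA : ∀ x : E (n + 1), ‖F ‖x‖‖ * (‖U ‖x‖‖ + ‖V ‖x‖‖) ≤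
      δ⁻¹ * ‖F ‖x‖‖ ^ 2 + δ / 2 * (‖U ‖x‖‖ ^ 2 + ‖V ‖x‖‖ ^ 2) := by
    intro x
    have : δ⁻¹ * ‖F ‖x‖‖ ^ 2 + δ / 2 * (‖U ‖x‖‖ ^ 2 + ‖V ‖x‖‖ ^ 2)
      - ‖F ‖x‖‖ * (‖U ‖x‖‖ + ‖V ‖x‖‖) = ((‖F ‖x‖‖ - δ * ‖U ‖x‖‖) ^ 2
        + (‖F ‖x‖‖ - δ * ‖V ‖x‖‖) ^ 2) / (2 * δ) := by field_simp; ring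
    have h0 : 0 ≤ ((‖F ‖x‖‖ - δ * ‖U ‖x‖‖) ^ 2
        + (‖F ‖x‖‖ - δ * ‖V ‖x‖‖) ^ 2) / (2 * δ) := by positivity
    linarith
  have iR := (iF.const_mul δ⁻¹).add (iP.const_mul (δ / 2))
  have iA : Integrable (fun x : E (n + 1) => ‖F ‖x‖‖ * (‖U ‖x‖‖ + ‖V ‖x‖‖)) := by
    have hm : Measurable fun r => ‖F r‖ * (‖U r‖ + ‖V r‖) :=
      hFm.norm.mul (hUc.measurable.norm.add hVc.measurable.norm)
    refine iR.mono' (hm.comp measurable_norm).aestronglyMeasurable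
      (Eventually.of_forall fun x => ?_)
    rw [Real.norm_of_nonneg (by positivity)]
    exact leA x
  have bA : ∫ x : E (n + 1), ‖F ‖x‖‖ * (‖U ‖x‖‖ + ‖V ‖x‖‖) ≤ 3 * (Q / δ) := by
    refine (integral_mono iA iR leA).trans ?_
    simp only [Pi.add_apply]
    rw [integral_add (iF.const_mul δ⁻¹) (iP.const_mul (δ / 2)), integral_const_mul,
      integral_const_mul]
    calc _ ≤ δ⁻¹ * Q + δ / 2 * (3 * Q / δ ^ 2) := by gcongr
      _ = (5 / 2) * (Q / δ) := by field_simp; ring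
      _ ≤ _ := by
        have : 0 < Q / δ := by positivity
        linarith
  have hdim : Module.finrank ℝ (E (n + 1)) = n + 1 := by simp
  have jP := (integrable_fun_norm_addHaar (volume : Measure (E (n + 1)))
    (f := fun r => ‖U r‖ ^ 2 + ‖V r‖ ^ 2)).mp iP
  have jA := (integrable_fun_norm_addHaar (volume : Measure (E (n + 1)))
    (f := fun r => ‖F r‖ * (‖U r‖ + ‖V r‖))).mp iA
  have kA := integral_fun_norm_addHaar (volume : Measure (E (n + 1)))
    (fun r => ‖F r‖ * (‖U r‖ + ‖V r‖))
  simp only [hdim, Nat.add_sub_cancel, smul_eq_mul, nsmul_eq_mul, Nat.cast_add, Nat.cast_one,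
    ← mul_assoc] at jP jA kA
  rw [← hκ] at kA
  have hM : ∫ r in Set.Ioi 0, r ^ n * (‖F r‖ * (‖U r‖ + ‖V r‖)) ≤
      Real.sqrt (3 / κ * (Q / δ)) ^ 2 := by
    rw [Real.sq_sqrt (by positivity)]
    rw [kA] at bA
    simp only [← mul_assoc (_ ^ n)]
    rw [div_mul_eq_mul_div, le_div_iff₀ hκ0]
    linarith
  have := hbound U V F (Real.sqrt (3 / κ * (Q / δ))) (by positivity) hUc hVc
    (fun r _ => hasDerivAt_profile hu r)
    (fun r _ => (hasDerivAt_deriv_profile hu r).congr_deriv (by simp only [hF, hV, hU]; ring))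
    jP (by simpa only [mul_assoc] using jA) hM
  rw [Real.sqrt_mul (by positivity), ← mul_assoc] at this
  refine ⟨fun x hx => ?_, fun x hx hx' => ?_⟩
  · rw [eU]
    exact this.1 _ hx
  · rw [eU]
    exact this.2 _ (norm_pos_iff.mpr hx) hx'

end RadialFunctions

/-! ### The `L^p` bound for smooth radial functions -/

section RadialLp

variable {n : ℕ}

theorem integrable_near_weight {α : ℝ} (R : ℝ) (hα : α < n + 1) :
    Integrable (fun x : E (n + 1) => (Set.Iic R).indicator (fun r => r ^ (-α)) ‖x‖) := by
  rw [integrable_fun_norm_addHaar (volume : Measure (E (n + 1)))]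
  simp only [finrank_euclideanSpace, Fintype.card_fin, Nat.add_sub_cancel, smul_eq_mul]
  have h1 : IntegrableOn (fun r : ℝ => r ^ ((n : ℝ) - α)) (Set.Ioc 0 R) := by
    rcases le_or_gt R 0 with h | h
    · rw [Set.Ioc_eq_empty (by linarith)]; exact integrableOn_empty
    · rw [← intervalIntegrable_iff_integrableOn_Ioc_of_le h.le]
      exact intervalIntegral.intervalIntegrable_rpow' (by linarith)
  have h2 : IntegrableOn ((Set.Ioc 0 R).indicator fun r : ℝ => r ^ ((n : ℝ) - α)) (Set.Ioi 0) :=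
    ((integrable_indicator_iff measurableSet_Ioc).mpr h1).integrableOn
  refine h2.congr_fun (fun r hr => ?_) measurableSet_Ioi
  have hr' : (0 : ℝ) < r := hr
  by_cases h : r ≤ R
  · simp [h, hr', Real.rpow_sub hr', Real.rpow_neg hr'.le, div_eq_mul_inv]
  · simp [h]

theorem integrable_far_weight {α : ℝ} {R : ℝ} (hR : 0 < R) (hα : n + 1 < α) :
    Integrable (fun x : E (n + 1) => (Set.Ici R).indicator (fun r => r ^ (-α)) ‖x‖) := by
  rw [integrable_fun_norm_addHaar (volume : Measure (E (n + 1)))]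
  simp only [finrank_euclideanSpace, Fintype.card_fin, Nat.add_sub_cancel, smul_eq_mul]
  have h1 : IntegrableOn (fun r : ℝ => r ^ ((n : ℝ) - α)) (Set.Ici R) := by
    rw [integrableOn_Ici_iff_integrableOn_Ioi]
    exact integrableOn_Ioi_rpow_of_lt (by linarith) hR
  have h2 : IntegrableOn ((Set.Ici R).indicator fun r : ℝ => r ^ ((n : ℝ) - α)) (Set.Ioi 0) :=
    ((integrable_indicator_iff measurableSet_Ici).mpr h1).integrableOn
  refine h2.congr_fun (fun r hr => ?_) measurableSet_Ioi
  have hr' : (0 : ℝ) < r := hr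
  by_cases h : R ≤ r
  · simp [h, Real.rpow_sub hr', Real.rpow_neg hr'.le, div_eq_mul_inv]
  · simp [h]

/-- The exponent `e` for which the Knapp examples `v` of frequency `1` satisfy
`‖v‖_p^p ∼ δ^(-e) Q^(p/2)`, where `Q = ‖Δv + v‖² + δ² ‖v‖²`. -/
def knappExp (n : ℕ) (p : ℝ) : ℝ := p - (n + 2) * (p - 2) / 4

/-- Radial functions satisfy an `L^p` bound that gains a power of `δ` over the Knapp examples. The
hypothesis `n p < 2 (n + 2)` is `p < 2_*` in dimension `N = n + 1`. The domain is split at the radii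
`n` and `n / δ`: the pointwise decay is used inside, and beyond it is combined with the `L²`
bound. -/
theorem radial_lintegral_bound (n : ℕ) (hn : 1 ≤ n) (p : ℝ) (hp : 2 < p)
    (hp' : n * p < 2 * (n + 2)) : ∃ C τ : ℝ, 0 < C ∧ 0 < τ ∧
    ∀ (u : E (n + 1) → ℂ) (Q δ : ℝ), 0 < Q → 0 < δ → δ ≤ 1 → ContDiff ℝ 2 u →
    (∀ x y, ‖x‖ = ‖y‖ → u x = u y) →
    Integrable (fun x => ‖u x‖ ^ 2) → ∫ x, ‖u x‖ ^ 2 ≤ Q / δ ^ 2 →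
    Integrable (fun x => ∑ i, ‖fderiv ℝ u x (EuclideanSpace.single i 1)‖ ^ 2) →
    ∫ x, ∑ i, ‖fderiv ℝ u x (EuclideanSpace.single i 1)‖ ^ 2 ≤ 2 * Q / δ ^ 2 →
    Integrable (fun x => ‖(Δ u) x + u x‖ ^ 2) → ∫ x, ‖(Δ u) x + u x‖ ^ 2 ≤ Q →
    ∫⁻ x, ENNReal.ofReal (‖u x‖ ^ p) ≤
      ENNReal.ofReal (C * δ ^ τ * (δ ^ (-knappExp n p) * Q ^ (p / 2))) := by
  obtain ⟨C, hC, hbound⟩ := radial_pointwise_bound n hn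
  have hn' : (1 : ℝ) ≤ n := by exact_mod_cast hn
  have hn0 : (0 : ℝ) < n := by linarith
  -- `μ` makes the far weight integrable while the loss `δ^(-μ)` stays below the Knapp rate
  obtain ⟨μ, hμ1, hμ2⟩ : ∃ μ : ℝ, max 0 (n + 1 - n * p / 2) < μ ∧ μ < (n + 2) / 2 - n * p / 4 := by
    apply exists_between
    rw [max_lt_iff]
    constructor
    · linarith
    · nlinarith
  have hμ0 : 0 < μ := (le_max_left _ _).trans_lt hμ1
  have hμ3 : n + 1 - n * p / 2 < μ := (le_max_right _ _).trans_lt hμ1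
  have hσp : p * nearExp n < n + 1 := by
    rw [nearExp, ← mul_div_assoc, div_lt_iff₀ (by positivity)]
    nlinarith
  have i1 := integrable_near_weight (n := n) n hσp
  have i2 := integrable_far_weight (n := n) hn0 (α := n * p / 2 + μ) (by linarith)
  set w1 : E (n + 1) → ℝ := fun x =>
    (Set.Iic (n : ℝ)).indicator (fun r => r ^ (-(p * nearExp n))) ‖x‖ with hw1
  set w2 : E (n + 1) → ℝ := fun x =>
    (Set.Ici (n : ℝ)).indicator (fun r => r ^ (-(n * p / 2 + μ))) ‖x‖ with hw2
  have w1nn : ∀ x, 0 ≤ w1 x := fun x => by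
    simp only [hw1, Set.indicator]; split_ifs <;> positivity
  have w2nn : ∀ x, 0 ≤ w2 x := fun x => by
    simp only [hw2, Set.indicator]; split_ifs <;> positivity
  set K1 := ∫ x, w1 x
  set K2 := ∫ x, w2 x
  have K1nn : 0 ≤ K1 := integral_nonneg w1nn
  have K2nn : 0 ≤ K2 := integral_nonneg w2nn
  set τ : ℝ := min ((n + 2) / 2 - n * p / 4 - μ) ((p - 2) * n / 4) with hτ
  have hτ0 : 0 < τ := lt_min (by linarith) (by have := sub_pos.mpr hp; positivity)
  have hτ1 : τ ≤ (n + 2) / 2 - n * p / 4 - μ := min_le_left _ _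
  have hτ2 : τ ≤ (p - 2) * n / 4 := min_le_right _ _
  refine ⟨C ^ p * K1 + C ^ p * (n : ℝ) ^ μ * K2 + C ^ (p - 2), τ, by positivity, hτ0, ?_⟩
  intro u Q δ hQ hδ hδ1 hu hrad hi0 hb0 hi1 hb1 hi2 hb2
  obtain ⟨far, near⟩ := hbound u Q δ hQ hδ hu hrad hi0 hb0 hi1 hb1 hi2 hb2
  set L : ℝ := n / δ with hL
  have hL0 : 0 < L := by positivity
  have hnL : n ≤ L := by rw [hL, le_div_iff₀ hδ]; nlinarith
  set B : ℝ := C * Real.sqrt (Q / δ) with hB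
  have hB0 : 0 < B := by positivity
  set D : ℝ := Q ^ (p / 2) with hD
  have hD0 : 0 < D := by positivity
  have hBpow : ∀ s : ℝ, B ^ s = C ^ s * (Q ^ (s / 2) * δ ^ (-(s / 2))) := by
    intro s
    rw [hB, Real.mul_rpow hC.le (by positivity), Real.sqrt_eq_rpow, ← Real.rpow_mul (by positivity),
      Real.div_rpow hQ.le hδ.le, Real.rpow_neg hδ.le, div_eq_mul_inv]
    ring_nf
  have hne : ∀ᵐ x : E (n + 1), x ≠ 0 := by simp [ae_iff, measure_singleton]
  -- the three summands dominate `‖u‖^p` for `‖x‖ ≤ n`, for `n < ‖x‖ ≤ L` and for `L < ‖x‖`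
  have hpw : ∀ x : E (n + 1), x ≠ 0 → ‖u x‖ ^ p ≤
      B ^ p * w1 x + B ^ p * L ^ μ * w2 x + (B * L ^ (-(n / 2 : ℝ))) ^ (p - 2) * ‖u x‖ ^ 2 := by
    intro x hx
    have hx0 : 0 < ‖x‖ := norm_pos_iff.mpr hx
    have t1 : 0 ≤ B ^ p * w1 x := mul_nonneg (by positivity) (w1nn x)
    have t2 : 0 ≤ B ^ p * L ^ μ * w2 x := mul_nonneg (by positivity) (w2nn x)
    have t3 : 0 ≤ (B * L ^ (-(n / 2 : ℝ))) ^ (p - 2) * ‖u x‖ ^ 2 := by positivity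
    rcases le_or_gt ‖x‖ n with h | h
    · have : ‖u x‖ ^ p ≤ B ^ p * w1 x := by
        calc ‖u x‖ ^ p ≤ (B * ‖x‖ ^ (-nearExp n)) ^ p :=
              Real.rpow_le_rpow (norm_nonneg _) (near x hx h) (by linarith)
          _ = B ^ p * w1 x := by
              rw [Real.mul_rpow hB0.le (by positivity), ← Real.rpow_mul hx0.le]
              simp only [hw1, Set.indicator, Set.mem_Iic, h, if_true]
              ring_nf
      linarith
    · rcases le_or_gt ‖x‖ L with h' | h'
      · have : ‖u x‖ ^ p ≤ B ^ p * L ^ μ * w2 x := by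
          calc ‖u x‖ ^ p ≤ (B * ‖x‖ ^ (-(n / 2 : ℝ))) ^ p :=
                Real.rpow_le_rpow (norm_nonneg _) (far x h.le) (by linarith)
            _ = B ^ p * ‖x‖ ^ μ * w2 x := by
                rw [Real.mul_rpow hB0.le (by positivity), ← Real.rpow_mul hx0.le]
                simp only [hw2, Set.indicator, Set.mem_Ici, h.le, if_true]
                rw [mul_assoc, ← Real.rpow_add hx0]
                ring_nf
            _ ≤ _ := by gcongr; exact w2nn x
        linarith
      · have : ‖u x‖ ^ p ≤ (B * L ^ (-(n / 2 : ℝ))) ^ (p - 2) * ‖u x‖ ^ 2 := by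
          have e1 : ‖u x‖ ≤ B * L ^ (-(n / 2 : ℝ)) := by
            refine (far x h.le).trans ?_
            gcongr ?_ * ?_
            exact Real.rpow_le_rpow_of_nonpos hL0 h'.le (by simp; positivity)
          have e2 : ‖u x‖ ^ p = ‖u x‖ ^ (p - 2) * ‖u x‖ ^ 2 := by
            rw [← Real.rpow_natCast, ← Real.rpow_add_of_nonneg (norm_nonneg _) (by linarith)
              (by norm_num)]
            norm_num
          rw [e2]
          gcongr
        linarith
  have i12 : Integrable fun x => B ^ p * w1 x + B ^ p * L ^ μ * w2 x :=
    (i1.const_mul (B ^ p)).add (i2.const_mul (B ^ p * L ^ μ))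
  have iR : Integrable fun x => B ^ p * w1 x + B ^ p * L ^ μ * w2 x +
      (B * L ^ (-(n / 2 : ℝ))) ^ (p - 2) * ‖u x‖ ^ 2 :=
    i12.add (hi0.const_mul ((B * L ^ (-(n / 2 : ℝ))) ^ (p - 2)))
  calc ∫⁻ x, ENNReal.ofReal (‖u x‖ ^ p)
      ≤ ∫⁻ x, ENNReal.ofReal (B ^ p * w1 x + B ^ p * L ^ μ * w2 x +
        (B * L ^ (-(n / 2 : ℝ))) ^ (p - 2) * ‖u x‖ ^ 2) := by
        apply lintegral_mono_ae
        filter_upwards [hne] with x hx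
        exact ENNReal.ofReal_le_ofReal (hpw x hx)
    _ = ENNReal.ofReal (∫ x, (B ^ p * w1 x + B ^ p * L ^ μ * w2 x +
        (B * L ^ (-(n / 2 : ℝ))) ^ (p - 2) * ‖u x‖ ^ 2)) := by
        rw [ofReal_integral_eq_lintegral_ofReal iR]
        refine Eventually.of_forall fun x => ?_
        have t1 : 0 ≤ B ^ p * w1 x := mul_nonneg (by positivity) (w1nn x)
        have t2 : 0 ≤ B ^ p * L ^ μ * w2 x := mul_nonneg (by positivity) (w2nn x)
        have t3 : 0 ≤ (B * L ^ (-(n / 2 : ℝ))) ^ (p - 2) * ‖u x‖ ^ 2 := by positivity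
        simp only [Pi.zero_apply]
        linarith
    _ ≤ _ := by
        apply ENNReal.ofReal_le_ofReal
        rw [integral_add i12
          (hi0.const_mul _), integral_add (i1.const_mul (B ^ p)) (i2.const_mul (B ^ p * L ^ μ)),
          integral_const_mul, integral_const_mul, integral_const_mul]
        set X : ℝ := δ ^ τ * (δ ^ (-knappExp n p) * D) with hX
        have hX' : X = D * δ ^ (τ - knappExp n p) := by
          rw [hX, sub_eq_add_neg, Real.rpow_add hδ]; ring
        have pow_le : ∀ s : ℝ, τ - knappExp n p ≤ s → D * δ ^ s ≤ X := by
          intro s hs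
          rw [hX']
          gcongr ?_ * ?_
          exact Real.rpow_le_rpow_of_exponent_ge hδ hδ1 hs
        have a1 : B ^ p * K1 ≤ C ^ p * K1 * X := by
          have : D * δ ^ (-(p / 2)) ≤ X := pow_le _ (by rw [knappExp]; linarith)
          rw [hBpow p]
          calc _ = C ^ p * K1 * (D * δ ^ (-(p / 2))) := by ring
            _ ≤ _ := by gcongr
        have a2 : B ^ p * L ^ μ * K2 ≤ C ^ p * (n : ℝ) ^ μ * K2 * X := by
          have : D * δ ^ (-(p / 2) + -μ) ≤ X := pow_le _ (by rw [knappExp]; linarith)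
          rw [hBpow p, hL, Real.div_rpow hn0.le hδ.le, div_eq_mul_inv ((n : ℝ) ^ μ),
            ← Real.rpow_neg hδ.le]
          rw [Real.rpow_add hδ] at this
          calc _ = C ^ p * (n : ℝ) ^ μ * K2 * (D * (δ ^ (-(p / 2)) * δ ^ (-μ))) := by ring
            _ ≤ _ := by gcongr
        have a3 : (B * L ^ (-(n / 2 : ℝ))) ^ (p - 2) * ∫ x, ‖u x‖ ^ 2 ≤ C ^ (p - 2) * X := by
          have : D * δ ^ (-((p - 2) / 2) + (n * (p - 2) / 2) + -2) ≤ X :=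
            pow_le _ (by rw [knappExp]; nlinarith)
          have l1 : L ^ (-(n / 2 : ℝ)) ≤ δ ^ (n / 2 : ℝ) := by
            rw [hL, Real.rpow_neg (by positivity), ← Real.inv_rpow (by positivity), inv_div]
            apply Real.rpow_le_rpow (by positivity) _ (by positivity)
            rw [div_le_iff₀ hn0]; nlinarith
          have l2 : (B * L ^ (-(n / 2 : ℝ))) ^ (p - 2) ≤ B ^ (p - 2) * δ ^ (n * (p - 2) / 2) := by
            calc _ ≤ (B * δ ^ (n / 2 : ℝ)) ^ (p - 2) := by gcongr
              _ = _ := by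
                rw [Real.mul_rpow hB0.le (by positivity), ← Real.rpow_mul hδ.le]
                ring_nf
          have l3 : Q / δ ^ 2 = Q * δ ^ (-2 : ℝ) := by
            rw [Real.rpow_neg hδ.le, div_eq_mul_inv]; norm_num
          have l4 : D = Q ^ ((p - 2) / 2) * Q := by
            rw [hD, ← Real.rpow_add_one hQ.ne']; ring_nf
          rw [Real.rpow_add hδ, Real.rpow_add hδ, l4] at this
          calc _ ≤ B ^ (p - 2) * δ ^ (n * (p - 2) / 2) * (Q / δ ^ 2) := by gcongr
            _ = C ^ (p - 2) * (Q ^ ((p - 2) / 2) * Q *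
                (δ ^ (-((p - 2) / 2)) * δ ^ (n * (p - 2) / 2) * δ ^ (-2 : ℝ))) := by
                rw [hBpow, l3]; ring
            _ ≤ _ := by gcongr
        calc _ ≤ C ^ p * K1 * X + C ^ p * (n : ℝ) ^ μ * K2 * X + C ^ (p - 2) * X :=
              add_le_add (add_le_add a1 a2) a3
          _ = _ := by rw [hX]; ring

end RadialLp

/-! ### Mollification of Sobolev functions -/

section Mollification

variable {N : ℕ} {ρ : E N → ℝ}

/-- The convolution of an `L²` function with a smooth kernel. -/
def mollify (ρ : E N → ℝ) (f : L2 N) (x : E N) : ℂ := ∫ y, ρ (x - y) • f y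

theorem mollify_eq_convolution (ρ : E N → ℝ) (f : L2 N) :
    mollify ρ f = (f ⋆[(ContinuousLinearMap.lsmul ℝ ℝ : ℝ →L[ℝ] ℂ →L[ℝ] ℂ).flip, volume] ρ) := by
  ext x
  simp [mollify, convolution]

/-- The kernel `y ↦ ρ (x - y)` as a complex Schwartz function. -/
def shiftKernel (hc : HasCompactSupport ρ) (hρ : ContDiff ℝ ∞ ρ) (x : E N) : 𝓢(E N, ℂ) :=
  HasCompactSupport.toSchwartzMap (f := fun y => ((ρ (x - y) : ℝ) : ℂ))
    ((hc.comp_homeomorph (Homeomorph.subLeft x)).comp_left (g := Complex.ofReal) rfl)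
    (Complex.ofRealCLM.contDiff.comp (hρ.comp (contDiff_const.sub contDiff_id)))

theorem mollify_eq_apply (hc : HasCompactSupport ρ) (hρ : ContDiff ℝ ∞ ρ) (f : L2 N) (x : E N) :
    mollify ρ f x = Lp.toTemperedDistribution f (shiftKernel hc hρ x) := by
  rw [Lp.toTemperedDistribution_apply, mollify]
  rfl

theorem mollify_add (hc : HasCompactSupport ρ) (hρ : ContDiff ℝ ∞ ρ) (f g : L2 N) (x : E N) :
    mollify ρ (f + g) x = mollify ρ f x + mollify ρ g x := by
  simp only [mollify_eq_apply hc hρ, toTD_add]; rfl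

theorem mollify_smul (f : L2 N) (c : ℂ) (x : E N) :
    mollify ρ (c • f) x = c * mollify ρ f x := by
  rw [mollify, mollify, ← integral_const_mul]
  apply integral_congr_ae
  filter_upwards [Lp.coeFn_smul c f] with y hy
  rw [hy]
  simp
  ring

theorem mollify_sum (hc : HasCompactSupport ρ) (hρ : ContDiff ℝ ∞ ρ) {ι : Type*} (s : Finset ι)
    (f : ι → L2 N) (x : E N) :
    mollify ρ (∑ i ∈ s, f i) x = ∑ i ∈ s, mollify ρ (f i) x :=
  map_sum (AddMonoidHom.mk' (fun f => mollify ρ f x) (fun f g => mollify_add hc hρ f g x)) f s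

theorem locallyIntegrable_coe (f : L2 N) : LocallyIntegrable f volume :=
  (Lp.memLp f).locallyIntegrable (by norm_num)

theorem contDiff_mollify (hc : HasCompactSupport ρ) (hρ : ContDiff ℝ ∞ ρ) (f : L2 N) :
    ContDiff ℝ ∞ (mollify ρ f) := by
  rw [mollify_eq_convolution]
  exact hc.contDiff_convolution_right _ (locallyIntegrable_coe f) hρ

theorem fderiv_mollify (hc : HasCompactSupport ρ) (hρ : ContDiff ℝ ∞ ρ) (f : L2 N) (x m : E N) :
    fderiv ℝ (mollify ρ f) x m = mollify (fun y => fderiv ℝ ρ y m) f x := by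
  rw [mollify_eq_convolution, mollify_eq_convolution,
    (hc.hasFDerivAt_convolution_right _ (locallyIntegrable_coe f)
      (hρ.of_le (by norm_num)) x).fderiv,
    convolution_precompR_apply _ (locallyIntegrable_coe f) (hc.fderiv ℝ)
      (hρ.continuous_fderiv (by norm_num))]

/-- Derivatives of a mollification are mollifications of weak derivatives. -/
theorem mollify_fderiv_kernel (hc : HasCompactSupport ρ) (hρ : ContDiff ℝ ∞ ρ) {f g : L2 N}
    {m : E N} (hg : Lp.toTemperedDistribution g = ∂_{m} (Lp.toTemperedDistribution f)) (x : E N) :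
    mollify (fun y => fderiv ℝ ρ y m) f x = mollify ρ g x := by
  rw [mollify_eq_apply hc hρ, hg, lineDerivOp_apply_apply, Lp.toTemperedDistribution_apply, mollify]
  congr 1
  ext y
  have h1 : HasFDerivAt (fun y => ((ρ (x - y) : ℝ) : ℂ))
      (Complex.ofRealCLM.comp (-(fderiv ℝ ρ (x - y)))) y := by
    have h2 : HasFDerivAt ρ (fderiv ℝ ρ (x - y)) (x - y) :=
      ((hρ.differentiable (by norm_num)) _).hasFDerivAt
    have h3 : HasFDerivAt (fun y : E N => x - y) (-(ContinuousLinearMap.id ℝ (E N))) y :=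
      (hasFDerivAt_id y).const_sub x
    have h4 := (Complex.ofRealCLM.hasFDerivAt (x := ρ (x - y))).comp y (h2.comp y h3)
    refine h4.congr_fderiv ?_
    ext v
    simp
  have h5 : (-∂_{m} (shiftKernel hc hρ x)) y = ((fderiv ℝ ρ (x - y) m : ℝ) : ℂ) := by
    rw [neg_apply, SchwartzMap.lineDerivOp_apply_eq_fderiv]
    have : fderiv ℝ (shiftKernel hc hρ x) y = Complex.ofRealCLM.comp (-(fderiv ℝ ρ (x - y))) :=
      h1.fderiv
    rw [this]
    simp
  rw [h5]
  simp

theorem fderiv_mollify_weakDeriv (hc : HasCompactSupport ρ) (hρ : ContDiff ℝ ∞ ρ) {u : L2 N}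
    (hu : u ∈ H2 N) (x : E N) (i : Fin N) :
    fderiv ℝ (mollify ρ u) x (EuclideanSpace.single i 1) = mollify ρ (weakDeriv i u) x := by
  rw [fderiv_mollify hc hρ, mollify_fderiv_kernel hc hρ (toTD_weakDeriv hu i)]

/-- The Laplacian of a mollification is the mollification of the weak Laplacian. -/
theorem laplacian_mollify (hc : HasCompactSupport ρ) (hρ : ContDiff ℝ ∞ ρ) {u : L2 N}
    (hu : u ∈ H2 N) (x : E N) : (Δ (mollify ρ u)) x = mollify ρ (weakLaplacian u) x := by
  rw [InnerProductSpace.laplacian_eq_iteratedFDeriv_orthonormalBasis _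
    (EuclideanSpace.basisFun (Fin N) ℝ), weakLaplacian_eq_sum hu, mollify_sum hc hρ]
  refine Finset.sum_congr rfl fun i _ => ?_
  rw [iteratedFDeriv_two_apply]
  simp only [Matrix.cons_val_zero, Matrix.cons_val_one, EuclideanSpace.basisFun_apply]
  have h1 : DifferentiableAt ℝ (fderiv ℝ (mollify ρ u)) x :=
    ((((contDiff_mollify hc hρ u).of_le (m := 2) (by norm_cast)).fderiv_right
      (m := 1) (by norm_num)).differentiable (by norm_num)) x
  have h2 := ((ContinuousLinearMap.apply ℝ ℂ
    (EuclideanSpace.single i (1 : ℝ) : E N)).hasFDerivAt).comp x h1.hasFDerivAt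
  have h3 : (fun y => fderiv ℝ (mollify ρ u) y (EuclideanSpace.single i 1)) =
      mollify ρ (weakDeriv i u) := funext fun y => fderiv_mollify_weakDeriv hc hρ hu y i
  have h4 : fderiv ℝ (fderiv ℝ (mollify ρ u)) x (EuclideanSpace.single i 1)
      (EuclideanSpace.single i 1) =
      fderiv ℝ (mollify ρ (weakDeriv i u)) x (EuclideanSpace.single i 1) := by
    rw [← h3]
    have h5 := h2.fderiv
    change fderiv ℝ (fun y => fderiv ℝ (mollify ρ u) y (EuclideanSpace.single i 1)) x = _ at h5
    rw [h5]
    rfl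
  rw [h4, fderiv_mollify hc hρ, mollify_fderiv_kernel hc hρ (g := weakDeriv₂ i i u)]
  rw [toTD_weakDeriv₂ hu, toTD_weakDeriv hu]

/-- Young's inequality `‖ρ * f‖₂ ≤ ‖f‖₂` for a probability density `ρ`. -/
theorem lintegral_mollify_sq_le (hρc : Continuous ρ) (hρ0 : ∀ x, 0 ≤ ρ x)
    (hρ1 : ∫⁻ x, ENNReal.ofReal (ρ x) = 1) (f : L2 N) :
    ∫⁻ x, ‖mollify ρ f x‖ₑ ^ 2 ≤ ∫⁻ x, ‖f x‖ₑ ^ 2 := by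
  have hfm : AEMeasurable (fun y => ‖f y‖ₑ) volume := (Lp.aestronglyMeasurable f).enorm
  have hk : ∀ x : E N, ∫⁻ y, ENNReal.ofReal (ρ (x - y)) = 1 := by
    intro x
    rw [← hρ1]
    exact lintegral_sub_left_eq_self (fun y => ENNReal.ofReal (ρ y)) x
  have hpt : ∀ x, ‖mollify ρ f x‖ₑ ^ 2 ≤ ∫⁻ y, ENNReal.ofReal (ρ (x - y)) * ‖f y‖ₑ ^ 2 := by
    intro x
    -- Hölder's inequality with the weight split evenly between the two factors
    set w : E N → ℝ≥0∞ := fun y => ENNReal.ofReal (ρ (x - y)) with hw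
    have hwm : Measurable w := by fun_prop
    have e1 : ‖mollify ρ f x‖ₑ ≤ ∫⁻ y, w y ^ (1 / 2 : ℝ) * (w y ^ (1 / 2 : ℝ) * ‖f y‖ₑ) := by
      refine (enorm_integral_le_lintegral_enorm _).trans (le_of_eq ?_)
      refine lintegral_congr fun y => ?_
      rw [enorm_smul, ← mul_assoc, ← ENNReal.rpow_add_of_nonneg _ _ (by norm_num) (by norm_num)]
      norm_num
      rw [hw, Real.enorm_of_nonneg (hρ0 _)]
    have e2 := ENNReal.lintegral_mul_le_Lp_mul_Lq volume Real.HolderConjugate.two_two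
      (f := fun y => w y ^ (1 / 2 : ℝ)) (g := fun y => w y ^ (1 / 2 : ℝ) * ‖f y‖ₑ)
      (by fun_prop) ((by fun_prop : AEMeasurable (fun y => w y ^ (1 / 2 : ℝ))).mul hfm)
    have e3 : ∀ y, (w y ^ (1 / 2 : ℝ)) ^ (2 : ℝ) = w y := by
      intro y; rw [← ENNReal.rpow_mul]; norm_num
    simp only [Pi.mul_apply, ENNReal.mul_rpow_of_nonneg _ _ (zero_le_two : (0 : ℝ) ≤ 2), e3] at e2
    have e4 : ∫⁻ y, w y = 1 := hk x
    rw [e4, ENNReal.one_rpow, one_mul] at e2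
    calc ‖mollify ρ f x‖ₑ ^ 2 ≤ ((∫⁻ y, w y * ‖f y‖ₑ ^ (2 : ℝ)) ^ (1 / 2 : ℝ)) ^ 2 := by
          gcongr; exact e1.trans e2
      _ = ∫⁻ y, w y * ‖f y‖ₑ ^ (2 : ℝ) := by
          rw [← ENNReal.rpow_natCast, ← ENNReal.rpow_mul]; norm_num
      _ = _ := by simp [hw]
  have hm : AEMeasurable (Function.uncurry fun x y : E N =>
      ENNReal.ofReal (ρ (x - y)) * ‖f y‖ₑ ^ 2) (volume.prod volume) := by
    have a1 : Measurable fun q : E N × E N => ENNReal.ofReal (ρ (q.1 - q.2)) := by fun_prop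
    exact a1.aemeasurable.mul ((hfm.comp_snd).pow_const 2)
  calc ∫⁻ x, ‖mollify ρ f x‖ₑ ^ 2
      ≤ ∫⁻ x, ∫⁻ y, ENNReal.ofReal (ρ (x - y)) * ‖f y‖ₑ ^ 2 := lintegral_mono hpt
    _ = ∫⁻ y, ∫⁻ x, ENNReal.ofReal (ρ (x - y)) * ‖f y‖ₑ ^ 2 := lintegral_lintegral_swap hm
    _ = ∫⁻ y, ‖f y‖ₑ ^ 2 := by
        refine lintegral_congr fun y => ?_
        rw [lintegral_mul_const _ (by fun_prop),
          lintegral_sub_right_eq_self (fun x => ENNReal.ofReal (ρ x)) y, hρ1, one_mul]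

theorem mollify_sq_integrable (hc : HasCompactSupport ρ) (hρ : ContDiff ℝ ∞ ρ) (hρ0 : ∀ x, 0 ≤ ρ x)
    (hρ1 : ∫⁻ x, ENNReal.ofReal (ρ x) = 1) (f : L2 N) :
    Integrable (fun x => ‖mollify ρ f x‖ ^ 2) ∧ ∫ x, ‖mollify ρ f x‖ ^ 2 ≤ ‖f‖ ^ 2 := by
  have hcont : Continuous (mollify ρ f) := (contDiff_mollify hc hρ f).continuous
  have e : ∀ z : ℂ, ENNReal.ofReal (‖z‖ ^ 2) = ‖z‖ₑ ^ 2 := by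
    intro z; rw [ENNReal.ofReal_pow (norm_nonneg _), ofReal_norm]
  have h1 := lintegral_mollify_sq_le hρ.continuous hρ0 hρ1 f
  have h2 : ∫⁻ x, ‖f x‖ₑ ^ 2 = ENNReal.ofReal (‖f‖ ^ 2) := by
    rw [norm_sq_eq_integral, ofReal_integral_eq_lintegral_ofReal (integrable_norm_sq f)
      (Eventually.of_forall fun x => by simp only [Pi.zero_apply]; positivity)]
    simp only [e]
  have h3 : ∫⁻ x, ENNReal.ofReal (‖mollify ρ f x‖ ^ 2) ≤ ENNReal.ofReal (‖f‖ ^ 2) := by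
    simp only [e]; rw [← h2]; exact h1
  refine ⟨⟨by fun_prop, ?_⟩, ?_⟩
  · rw [hasFiniteIntegral_iff_ofReal (Eventually.of_forall fun x => by
      simp only [Pi.zero_apply]; positivity)]
    exact h3.trans_lt ENNReal.ofReal_lt_top
  · rw [integral_eq_lintegral_of_nonneg_ae (Eventually.of_forall fun x => by
      simp only [Pi.zero_apply]; positivity) (by fun_prop)]
    exact ENNReal.toReal_le_of_le_ofReal (by positivity) h3

theorem ae_comp_isometry {f : L2 N} (hf : IsRadial f) (A : E N ≃ₗᵢ[ℝ] E N) :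
    ∀ᵐ x, f (A x) = f x := by
  obtain ⟨g, hg⟩ := hf
  filter_upwards [hg, A.measurePreserving.quasiMeasurePreserving.ae hg] with x h1 h2
  rw [h1, h2, A.norm_map]

/-- Mollification with a radial kernel preserves radial symmetry. -/
theorem mollify_radial (hρ : ∀ x y, ‖x‖ = ‖y‖ → ρ x = ρ y) {f : L2 N} (hf : IsRadial f)
    (x y : E N) (hxy : ‖x‖ = ‖y‖) : mollify ρ f x = mollify ρ f y := by
  -- the reflection that exchanges `x` and `y`
  set A : E N ≃ₗᵢ[ℝ] E N := (ℝ ∙ (x - y))ᗮ.reflection with hA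
  have hAx : A x = y := Submodule.reflection_sub hxy
  rw [mollify, mollify, ← (A.measurePreserving).integral_comp A.toHomeomorph.measurableEmbedding
    (fun z => ρ (y - z) • f z)]
  apply integral_congr_ae
  filter_upwards [ae_comp_isometry hf A] with z hz
  rw [hz, ← hAx, ← map_sub, hρ _ _ (A.norm_map _)]

end Mollification

/-! ### The `L^p` bound for radial Sobolev functions -/

section RadialKernels

variable {N : ℕ}

/-- A smooth radial function with values in `[0, 1]`, supported in the closed unit ball. Written as
a function of `‖x‖²` it is smooth at the origin. -/
def radialBump (x : E N) : ℝ := Real.smoothTransition (1 - ‖x‖ ^ 2)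

theorem contDiff_radialBump : ContDiff ℝ ∞ (radialBump (N := N)) :=
  Real.smoothTransition.contDiff.comp (contDiff_const.sub (contDiff_norm_sq ℝ))

theorem radialBump_eq_zero {x : E N} (hx : 1 ≤ ‖x‖) : radialBump x = 0 :=
  Real.smoothTransition.zero_of_nonpos (by nlinarith)

theorem hasCompactSupport_radialBump : HasCompactSupport (radialBump (N := N)) := by
  refine HasCompactSupport.intro (isCompact_closedBall (0 : E N) 1) fun x hx => ?_
  apply radialBump_eq_zero
  rw [mem_closedBall_zero_iff, not_le] at hx
  exact hx.le

theorem radialBump_nonneg (x : E N) : 0 ≤ radialBump x := Real.smoothTransition.nonneg _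

theorem radialBump_le_one (x : E N) : radialBump x ≤ 1 := Real.smoothTransition.le_one _

theorem radialBump_zero : radialBump (0 : E N) = 1 := by simp [radialBump]

theorem integral_radialBump_pos : 0 < ∫ x : E N, radialBump x :=
  contDiff_radialBump.continuous.integral_pos_of_hasCompactSupport_nonneg_nonzero
    hasCompactSupport_radialBump radialBump_nonneg (by rw [radialBump_zero]; exact one_ne_zero)

/-- Radial probability densities that concentrate at the origin: `radialKernel k` is supported in
the ball of radius `1 / (k + 1)`. -/
def radialKernel (k : ℕ) (x : E N) : ℝ :=
  (∫ y : E N, radialBump y)⁻¹ * ((k + 1 : ℝ) ^ N * radialBump ((k + 1 : ℝ) • x))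

theorem contDiff_radialKernel (k : ℕ) : ContDiff ℝ ∞ (radialKernel (N := N) k) :=
  contDiff_const.mul (contDiff_const.mul (contDiff_radialBump.comp (contDiff_const_smul _)))

theorem radialKernel_nonneg (k : ℕ) (x : E N) : 0 ≤ radialKernel k x := by
  unfold radialKernel
  have h1 := radialBump_nonneg ((k + 1 : ℝ) • x)
  have h2 := (integral_radialBump_pos (N := N)).le
  exact mul_nonneg (inv_nonneg.mpr h2) (mul_nonneg (by positivity) h1)

theorem radialKernel_eq_zero {k : ℕ} {x : E N} (hx : (k + 1 : ℝ)⁻¹ ≤ ‖x‖) :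
    radialKernel k x = 0 := by
  have hk : (0 : ℝ) < k + 1 := by positivity
  rw [radialKernel, radialBump_eq_zero, mul_zero, mul_zero]
  rw [norm_smul, Real.norm_of_nonneg hk.le]
  rwa [inv_le_iff_one_le_mul₀' hk] at hx

theorem hasCompactSupport_radialKernel (k : ℕ) : HasCompactSupport (radialKernel (N := N) k) := by
  refine HasCompactSupport.intro (isCompact_closedBall (0 : E N) (k + 1 : ℝ)⁻¹) fun x hx => ?_
  apply radialKernel_eq_zero
  rw [mem_closedBall_zero_iff, not_le] at hx
  exact hx.le

theorem radialKernel_radial (k : ℕ) (x y : E N) (h : ‖x‖ = ‖y‖) :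
    radialKernel k x = radialKernel k y := by
  simp [radialKernel, radialBump, norm_smul, h]

theorem integral_radialKernel (k : ℕ) : ∫ x : E N, radialKernel k x = 1 := by
  have hk : (0 : ℝ) < k + 1 := by positivity
  have h0 := (integral_radialBump_pos (N := N)).ne'
  simp only [radialKernel]
  rw [integral_const_mul, integral_const_mul,
    Measure.integral_comp_smul_of_nonneg volume _ _ (hR := hk.le), finrank_euclideanSpace,
    Fintype.card_fin, smul_eq_mul]
  field_simp

theorem lintegral_radialKernel (k : ℕ) : ∫⁻ x : E N, ENNReal.ofReal (radialKernel k x) = 1 := by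
  rw [← ofReal_integral_eq_lintegral_ofReal, integral_radialKernel, ENNReal.ofReal_one]
  · exact (contDiff_radialKernel k).continuous.integrable_of_hasCompactSupport
      (hasCompactSupport_radialKernel k)
  · exact Eventually.of_forall (radialKernel_nonneg k)

theorem ae_tendsto_mollify (f : L2 N) :
    ∀ᵐ x, Tendsto (fun k => mollify (radialKernel k) f x) atTop (𝓝 (f x)) := by
  have hf := locallyIntegrable_coe f
  filter_upwards
    [(Besicovitch.vitaliFamily (volume : Measure (E N))).ae_tendsto_average_norm_sub hf] with x hx
  set r : ℕ → ℝ := fun k => (k + 1 : ℝ)⁻¹ with hr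
  have hr0 : ∀ k, 0 < r k := fun k => by simp only [hr]; positivity
  have hrt : Tendsto r atTop (𝓝[>] 0) := by
    refine tendsto_nhdsWithin_iff.2 ⟨?_, Eventually.of_forall hr0⟩
    simpa [hr] using tendsto_one_div_add_atTop_nhds_zero_nat (𝕜 := ℝ)
  have hx' := (hx.comp (Besicovitch.tendsto_filterAt volume x)).comp hrt
  apply tendsto_integral_smul_of_tendsto_average_norm_sub
    ((∫ y : E N, radialBump y)⁻¹ * (volume : Measure (E N)).real (Metric.ball 0 1)) hx'
  · exact Eventually.of_forall fun k => hf.integrableOn_isCompact (isCompact_closedBall _ _)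
  · refine tendsto_const_nhds.congr fun k => ?_
    rw [integral_sub_left_eq_self, integral_radialKernel]
  · refine Eventually.of_forall fun k y hy => ?_
    rw [Metric.mem_closedBall, dist_comm, dist_eq_norm]
    by_contra! h
    exact hy (radialKernel_eq_zero h.le)
  · refine Eventually.of_forall fun k y => ?_
    have hv : (0 : ℝ) < (volume : Measure (E N)).real (Metric.ball 0 1) :=
      ENNReal.toReal_pos (Metric.measure_ball_pos _ _ one_pos).ne' measure_ball_lt_top.ne
    have hc := integral_radialBump_pos (N := N)
    rw [abs_of_nonneg (radialKernel_nonneg _ _), radialKernel,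
      Measure.addHaar_real_closedBall _ _ (hr0 k).le, finrank_euclideanSpace, Fintype.card_fin]
    have h1 := radialBump_le_one ((k + 1 : ℝ) • (x - y))
    have h2 : ((k : ℝ) + 1) ^ N = (r k ^ N)⁻¹ := by simp [hr]
    have h3 : (0 : ℝ) < (k + 1) ^ N := by positivity
    have h5 : 0 < r k ^ N := pow_pos (hr0 k) _
    calc _ ≤ (∫ y : E N, radialBump y)⁻¹ * ((k + 1 : ℝ) ^ N * 1) := by gcongr
      _ = _ := by rw [h2]; field_simp

end RadialKernels

section RadialSobolev

theorem lintegral_comp_smul {N : ℕ} {g : E N → ℝ≥0∞} (hg : Measurable g) {c : ℝ} (hc : 0 < c) :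
    ∫⁻ x, g (c • x) = ENNReal.ofReal ((c ^ N)⁻¹) * ∫⁻ x, g x := by
  rw [← lintegral_map hg (measurable_const_smul c), Measure.map_addHaar_smul _ hc.ne',
    lintegral_smul_measure, finrank_euclideanSpace, Fintype.card_fin, abs_of_pos (by positivity)]
  rfl

/-- The `L^p` norm of a radial `H²` function is controlled by its quadratic form, with a gain of
the power `δ^τ` over the Knapp examples. The function is mollified and rescaled to frequency `1`,
and Fatou's lemma removes the mollification. -/
theorem radial_lower_bound (n : ℕ) (hn : 1 ≤ n) (p : ℝ) (hp : 2 < p)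
    (hp' : n * p < 2 * (n + 2)) : ∃ C τ : ℝ, 0 < C ∧ 0 < τ ∧
    ∀ (u : L2 (n + 1)) (Q δ l : ℝ), u ∈ H2 (n + 1) → IsRadial u → 0 < Q → 0 < δ → δ ≤ 1 → 0 < l →
    ‖weakLaplacian u + ((l ^ 2 : ℝ) : ℂ) • u‖ ^ 2 + δ ^ 2 * l ^ 4 * ‖u‖ ^ 2 ≤ Q →
    ∫⁻ x, ENNReal.ofReal (‖u x‖ ^ p) ≤ ENNReal.ofReal ((l ^ (n + 1))⁻¹ *
      (C * δ ^ τ * (δ ^ (-knappExp n p) * (l ^ (n + 1) / l ^ 4 * Q) ^ (p / 2)))) := by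
  obtain ⟨C, τ, hC, hτ, hbound⟩ := radial_lintegral_bound n hn p hp hp'
  refine ⟨C, τ, hC, hτ, ?_⟩
  intro u Q δ l hu hrad hQ hδ hδ1 hl hle
  set f : L2 (n + 1) := weakLaplacian u + ((l ^ 2 : ℝ) : ℂ) • u with hf
  have hfQ : ‖f‖ ^ 2 ≤ Q := le_trans (le_add_of_nonneg_right (by positivity)) hle
  have huQ : δ ^ 2 * l ^ 4 * ‖u‖ ^ 2 ≤ Q := le_trans (le_add_of_nonneg_left (by positivity)) hle
  have hgrad : l ^ 2 * ∑ i, ‖weakDeriv i u‖ ^ 2 ≤ 2 * Q / δ ^ 2 := by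
    have e1 : ∑ i, ‖weakDeriv i u‖ ^ 2 ≤ l ^ 2 * ‖u‖ ^ 2 + ‖f‖ * ‖u‖ := by
      have h1 : weakLaplacian u = f - ((l ^ 2 : ℝ) : ℂ) • u := by rw [hf, add_sub_cancel_right]
      rw [sum_norm_sq_weakDeriv hu, h1, inner_sub_left, inner_smul_left, Complex.conj_ofReal,
        Complex.sub_re, Complex.re_ofReal_mul, inner_self_eq_norm_sq_to_K]
      have h2 := (abs_le.mp ((Complex.abs_re_le_norm _).trans (norm_inner_le_norm (𝕜 := ℂ) f u))).1
      have h3 : (((‖u‖ : ℝ) : ℂ) ^ 2).re = ‖u‖ ^ 2 := by norm_cast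
      change -((inner ℂ f u).re - l ^ 2 * (((‖u‖ : ℝ) : ℂ) ^ 2).re) ≤ _
      rw [h3]
      linarith
    have e2 : δ ^ 2 * (l ^ 2 * (‖f‖ * ‖u‖)) ≤ Q := by
      have a1 : (δ * l ^ 2 * ‖u‖) ^ 2 ≤ Q := by
        calc _ = δ ^ 2 * l ^ 4 * ‖u‖ ^ 2 := by ring
          _ ≤ _ := huQ
      have a2 : 0 ≤ δ * l ^ 2 * ‖u‖ := by positivity
      have a3 : ‖f‖ * (δ * l ^ 2 * ‖u‖) ≤ Q := by
        nlinarith [sq_nonneg (‖f‖ - δ * l ^ 2 * ‖u‖)]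
      calc δ ^ 2 * (l ^ 2 * (‖f‖ * ‖u‖)) = δ * (‖f‖ * (δ * l ^ 2 * ‖u‖)) := by ring
        _ ≤ 1 * (‖f‖ * (δ * l ^ 2 * ‖u‖)) := by gcongr
        _ ≤ Q := by rw [one_mul]; exact a3
    rw [le_div_iff₀ (by positivity)]
    calc _ ≤ l ^ 2 * (l ^ 2 * ‖u‖ ^ 2 + ‖f‖ * ‖u‖) * δ ^ 2 := by gcongr
      _ = δ ^ 2 * l ^ 4 * ‖u‖ ^ 2 + δ ^ 2 * (l ^ 2 * (‖f‖ * ‖u‖)) := by ring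
      _ ≤ _ := by linarith
  have hscale : ∀ g : E (n + 1) → ℝ, ∫ x, g (l⁻¹ • x) = l ^ (n + 1) * ∫ x, g x := by
    intro g
    rw [Measure.integral_comp_smul_of_nonneg volume _ _ (hR := by positivity),
      finrank_euclideanSpace, Fintype.card_fin, smul_eq_mul, inv_pow, inv_inv]
  set Q' : ℝ := l ^ (n + 1) / l ^ 4 * Q with hQ'
  have hQ'0 : 0 < Q' := by positivity
  have key : ∀ k, ∫⁻ x, ENNReal.ofReal (‖mollify (radialKernel k) u x‖ ^ p) ≤
      ENNReal.ofReal ((l ^ (n + 1))⁻¹ *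
      (C * δ ^ τ * (δ ^ (-knappExp n p) * Q' ^ (p / 2)))) := by
    intro k
    have hc := hasCompactSupport_radialKernel (N := n + 1) k
    have hρ := contDiff_radialKernel (N := n + 1) k
    have hmi := fun g : L2 (n + 1) => mollify_sq_integrable hc hρ (radialKernel_nonneg k)
      (lintegral_radialKernel k) g
    set v := mollify (radialKernel k) u with hv
    have hv2 : ContDiff ℝ 2 v := (contDiff_mollify hc hρ u).of_le (by norm_cast)
    have hvp : Measurable fun x => ENNReal.ofReal (‖v x‖ ^ p) := by
      have := hv2.continuous.measurable
      fun_prop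
    -- rescaling turns `Δ + l²` into `l² (Δ + 1)`
    set w : E (n + 1) → ℂ := fun x => v (l⁻¹ • x) with hw
    have hw2 : ContDiff ℝ 2 w := hv2.comp (contDiff_const_smul _)
    have hwrad : ∀ x y, ‖x‖ = ‖y‖ → w x = w y := fun x y hxy =>
      mollify_radial (radialKernel_radial k) hrad _ _ (by simp [norm_smul, hxy])
    have hwd : ∀ x i, ‖fderiv ℝ w x (EuclideanSpace.single i 1)‖ ^ 2 =
        (l ^ 2)⁻¹ * ‖mollify (radialKernel k) (weakDeriv i u) (l⁻¹ • x)‖ ^ 2 := by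
      intro x i
      rw [hw, fderiv_comp_smul, smul_apply, fderiv_mollify_weakDeriv hc hρ hu,
        norm_smul, mul_pow, Real.norm_of_nonneg (by positivity), inv_pow]
    have hwl : ∀ x, ‖(Δ w) x + w x‖ ^ 2 =
        (l ^ 4)⁻¹ * ‖mollify (radialKernel k) f (l⁻¹ • x)‖ ^ 2 := by
      intro x
      have h1 : (Δ w) x = ((l⁻¹ : ℝ) ^ 2) • (Δ v) (l⁻¹ • x) := by
        rw [InnerProductSpace.laplacian_eq_iteratedFDeriv_orthonormalBasis _
          (EuclideanSpace.basisFun (Fin (n + 1)) ℝ),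
          InnerProductSpace.laplacian_eq_iteratedFDeriv_orthonormalBasis _
          (EuclideanSpace.basisFun (Fin (n + 1)) ℝ), Finset.smul_sum, hw,
          iteratedFDeriv_comp_const_smul (i := 2) _ (by exact_mod_cast hv2)]
        rfl
      have h2 : (Δ w) x + w x =
          ((l⁻¹ : ℝ) ^ 2) • mollify (radialKernel k) f (l⁻¹ • x) := by
        rw [h1, hf, mollify_add hc hρ, mollify_smul, laplacian_mollify hc hρ hu, hw]
        simp only [Complex.real_smul]
        push_cast
        have : (l : ℂ) ≠ 0 := by exact_mod_cast hl.ne'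
        field_simp
        rfl
      rw [h2, norm_smul, mul_pow, Real.norm_of_nonneg (by positivity)]
      congr 1
      rw [← pow_mul, inv_pow]
    have hli : l⁻¹ ≠ 0 := by positivity
    have fin := hbound w Q' δ hQ'0 hδ hδ1 hw2 hwrad ((hmi u).1.comp_smul hli) ?_ ?_ ?_ ?_ ?_
    · have h1 : ∫⁻ x, ENNReal.ofReal (‖w x‖ ^ p) =
          ENNReal.ofReal (((l⁻¹) ^ (n + 1))⁻¹) * ∫⁻ x, ENNReal.ofReal (‖v x‖ ^ p) :=
        lintegral_comp_smul hvp (by positivity)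
      rw [h1] at fin
      rw [ENNReal.ofReal_mul (by positivity)]
      have h2 : ENNReal.ofReal ((l ^ (n + 1))⁻¹) * ENNReal.ofReal (((l⁻¹) ^ (n + 1))⁻¹) = 1 := by
        rw [← ENNReal.ofReal_mul (by positivity), inv_pow, inv_inv, inv_mul_cancel₀ (by positivity),
          ENNReal.ofReal_one]
      calc ∫⁻ x, ENNReal.ofReal (‖v x‖ ^ p) = ENNReal.ofReal ((l ^ (n + 1))⁻¹) *
            (ENNReal.ofReal (((l⁻¹) ^ (n + 1))⁻¹) * ∫⁻ x, ENNReal.ofReal (‖v x‖ ^ p)) := by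
            rw [← mul_assoc, h2, one_mul]
        _ ≤ _ := by gcongr
    · rw [hscale fun x => ‖v x‖ ^ 2, le_div_iff₀ (by positivity), hQ']
      calc l ^ (n + 1) * (∫ x, ‖v x‖ ^ 2) * δ ^ 2 ≤ l ^ (n + 1) * ‖u‖ ^ 2 * δ ^ 2 := by
            gcongr; exact (hmi u).2
        _ = l ^ (n + 1) / l ^ 4 * (δ ^ 2 * l ^ 4 * ‖u‖ ^ 2) := by field_simp
        _ ≤ _ := by gcongr
    · simp only [hwd]
      exact integrable_finsetSum _ fun i _ => ((hmi (weakDeriv i u)).1.comp_smul hli).const_mul _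
    · simp only [hwd]
      rw [integral_finsetSum _ fun i _ => ((hmi (weakDeriv i u)).1.comp_smul hli).const_mul _]
      have h1 : ∀ i, ∫ x, (l ^ 2)⁻¹ * ‖mollify (radialKernel k) (weakDeriv i u) (l⁻¹ • x)‖ ^ 2 ≤
          (l ^ 2)⁻¹ * (l ^ (n + 1) * ‖weakDeriv i u‖ ^ 2) := by
        intro i
        rw [integral_const_mul, hscale fun x => ‖mollify (radialKernel k) (weakDeriv i u) x‖ ^ 2]
        gcongr
        exact (hmi _).2
      refine (Finset.sum_le_sum fun i _ => h1 i).trans ?_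
      rw [← Finset.mul_sum, ← Finset.mul_sum, hQ']
      calc _ = l ^ (n + 1) / l ^ 4 * (l ^ 2 * ∑ i, ‖weakDeriv i u‖ ^ 2) := by field_simp
        _ ≤ l ^ (n + 1) / l ^ 4 * (2 * Q / δ ^ 2) := by gcongr
        _ = _ := by ring
    · simp only [hwl]
      exact ((hmi f).1.comp_smul hli).const_mul _
    · simp only [hwl]
      rw [integral_const_mul, hscale fun x => ‖mollify (radialKernel k) f x‖ ^ 2, hQ']
      calc _ ≤ (l ^ 4)⁻¹ * (l ^ (n + 1) * Q) := by gcongr; exact (hmi f).2.trans hfQ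
        _ = _ := by ring
  have hlim : ∀ᵐ x, ENNReal.ofReal (‖u x‖ ^ p) =
      liminf (fun k => ENNReal.ofReal (‖mollify (radialKernel k) u x‖ ^ p)) atTop := by
    filter_upwards [ae_tendsto_mollify u] with x hx
    have := (ENNReal.continuous_ofReal.tendsto _).comp
      ((hx.norm).rpow_const (Or.inr (by linarith : 0 ≤ p)))
    exact this.liminf_eq.symm
  rw [lintegral_congr_ae hlim]
  refine (lintegral_liminf_le fun k => ?_).trans ?_
  · have := (contDiff_mollify (hasCompactSupport_radialKernel k) (contDiff_radialKernel k)
      u).continuous.measurable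
    fun_prop
  · exact liminf_le_of_le (by isBoundedDefault) fun b hb => by
      obtain ⟨k, hk⟩ := hb.exists
      exact hk.trans (key k)

end RadialSobolev

/-! ### Knapp examples -/

section SchwartzRepresentatives

variable {N : ℕ}

theorem schwartz_mem_H2 (φ : 𝓢(E N, ℂ)) : φ.toLp 2 volume ∈ H2 N := by
  change MemSobolev 2 2 (Lp.toTemperedDistribution (φ.toLp 2 volume))
  rw [Lp.toTemperedDistribution_toLp_eq]
  exact φ.memSobolev

theorem weakLaplacian_schwartz (φ : 𝓢(E N, ℂ)) :
    weakLaplacian (φ.toLp 2 volume) = (Δ φ).toLp 2 volume := by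
  apply l2Rep_eq
  rw [Lp.toTemperedDistribution_toLp_eq, Lp.toTemperedDistribution_toLp_eq,
    TemperedDistribution.laplacian_toTemperedDistributionCLM_eq]

end SchwartzRepresentatives

section Knapp

variable {n : ℕ}

/-- The diagonal map that stretches the first coordinate by `a` and the others by `b`. -/
def stretch (n : ℕ) (a b : ℝ) : E (n + 1) →ₗ[ℝ] E (n + 1) :=
  Matrix.toLin (EuclideanSpace.basisFun (Fin (n + 1)) ℝ).toBasis
    (EuclideanSpace.basisFun (Fin (n + 1)) ℝ).toBasis (Matrix.diagonal (Fin.cons a fun _ => b))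

theorem stretch_single (a b : ℝ) (i : Fin (n + 1)) :
    stretch n a b (EuclideanSpace.single i 1) =
      (Fin.cons a (fun _ => b) : Fin (n + 1) → ℝ) i • EuclideanSpace.single i 1 := by
  have h := Matrix.toLin_self (EuclideanSpace.basisFun (Fin (n + 1)) ℝ).toBasis
    (EuclideanSpace.basisFun (Fin (n + 1)) ℝ).toBasis (Matrix.diagonal (Fin.cons a fun _ => b)) i
  simpa [stretch, Matrix.diagonal_apply] using h

theorem stretch_apply (a b : ℝ) (x : E (n + 1)) (i : Fin (n + 1)) :
    stretch n a b x i = (Fin.cons a (fun _ => b) : Fin (n + 1) → ℝ) i * x i := by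
  have h1 : x = ∑ i, x i • (EuclideanSpace.single i 1 : E (n + 1)) := by
    conv_lhs => rw [← (EuclideanSpace.basisFun (Fin (n + 1)) ℝ).sum_repr x]
    simp
  conv_lhs => rw [h1]
  simp only [map_sum, map_smul, stretch_single]
  simp [Finset.sum_apply, Pi.single_apply, mul_comm]

theorem det_stretch (a b : ℝ) : LinearMap.det (stretch n a b) = a * b ^ n := by
  rw [stretch, LinearMap.det_toLin, Matrix.det_diagonal, Fin.prod_univ_succ]
  simp

theorem integral_comp_stretch {a b : ℝ} (ha : 0 < a) (hb : 0 < b) {g : E (n + 1) → ℝ}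
    (hg : Continuous g) : ∫ x, g (stretch n a b x) = (a * b ^ n)⁻¹ * ∫ x, g x := by
  have hdet : LinearMap.det (stretch n a b) ≠ 0 := by rw [det_stretch]; positivity
  have hc : Continuous (stretch n a b) := LinearMap.continuous_of_finiteDimensional _
  rw [← integral_map hc.aemeasurable (by fun_prop) (f := g),
    Measure.map_linearMap_addHaar_eq_smul_addHaar _ hdet, integral_smul_measure, det_stretch,
    abs_of_pos (by positivity), ENNReal.toReal_ofReal (by positivity), smul_eq_mul]

theorem norm_le_norm_stretch {a b : ℝ} (ha : 0 < a) (hab : a ≤ b) (x : E (n + 1)) :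
    a * ‖x‖ ≤ ‖stretch n a b x‖ := by
  apply le_of_sq_le_sq _ (norm_nonneg _)
  rw [mul_pow, EuclideanSpace.norm_sq_eq, EuclideanSpace.norm_sq_eq, Finset.mul_sum]
  refine Finset.sum_le_sum fun i _ => ?_
  rw [stretch_apply, norm_mul, mul_pow]
  gcongr
  refine Fin.cases ?_ (fun j => ?_) i
  · simp [le_abs_self]
  · simpa using hab.trans (le_abs_self b)

/-- The Knapp example: a plane wave of frequency `l` in the first coordinate, modulated by the
profile `φ` adapted to an anisotropic box. -/
def knappFun (l : ℝ) (A : E (n + 1) →ₗ[ℝ] E (n + 1)) (φ : E (n + 1) → ℂ) (x : E (n + 1)) : ℂ :=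
  Complex.exp (Complex.I * l * (x 0 : ℝ)) * φ (A x)

theorem contDiff_knappFun {k : WithTop ℕ∞} (l : ℝ) (A : E (n + 1) →ₗ[ℝ] E (n + 1))
    {φ : E (n + 1) → ℂ} (hφ : ContDiff ℝ k φ) : ContDiff ℝ k (knappFun l A φ) := by
  have h1 : ContDiff ℝ k fun x : E (n + 1) => ((x 0 : ℝ) : ℂ) :=
    Complex.ofRealCLM.contDiff.comp (contDiff_piLp_apply (i := (0 : Fin (n + 1))) 2)
  have h2 : ContDiff ℝ k A := (LinearMap.toContinuousLinearMap A).contDiff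
  exact (contDiff_const.mul h1).cexp.mul (hφ.comp h2)

theorem norm_knappFun (l : ℝ) (A : E (n + 1) →ₗ[ℝ] E (n + 1)) (φ : E (n + 1) → ℂ) (x : E (n + 1)) :
    ‖knappFun l A φ x‖ = ‖φ (A x)‖ := by
  rw [knappFun, norm_mul, Complex.norm_exp]
  simp

/-- Second derivatives of the Knapp example along an eigenvector `e` of `A`. -/
theorem fderiv_fderiv_knappFun (l : ℝ) (A : E (n + 1) →ₗ[ℝ] E (n + 1)) {φ : E (n + 1) → ℂ}
    (hφ : ContDiff ℝ 2 φ) (x e : E (n + 1)) (α : ℝ) (hα : A e = α • e) :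
    fderiv ℝ (fderiv ℝ (knappFun l A φ)) x e e = Complex.exp (Complex.I * l * (x 0 : ℝ)) *
      ((Complex.I * l * (e 0 : ℝ)) ^ 2 * φ (A x) + 2 * (Complex.I * l * (e 0 : ℝ)) *
        (α * fderiv ℝ φ (A x) e) + α ^ 2 * fderiv ℝ (fderiv ℝ φ) (A x) e e) := by
  set s : ℂ := Complex.I * l * (e 0 : ℝ) with hs
  set w : ℝ → ℂ := fun t => Complex.exp (Complex.I * l * (x 0 : ℝ) + t * s) with hw
  have hwd : ∀ t, HasDerivAt w (w t * s) t := by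
    intro t
    have h1 : HasDerivAt (fun t : ℝ => Complex.I * l * ((x 0 : ℝ) : ℂ) + (t : ℂ) * s) s t := by
      have := ((hasDerivAt_id t).ofReal_comp.mul_const s).const_add
        (Complex.I * l * ((x 0 : ℝ) : ℂ))
      simpa using this
    exact h1.cexp
  have hline : ∀ t : ℝ, A (x + t • e) = A x + (t * α) • e := by
    intro t; rw [map_add, map_smul, hα, smul_smul]
  have hin : ∀ t : ℝ, HasDerivAt (fun t : ℝ => t * α) α t := fun t => by
    simpa using (hasDerivAt_id t).mul_const α
  have hψ : ∀ t : ℝ, HasDerivAt (fun t : ℝ => φ (A (x + t • e)))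
      (α * fderiv ℝ φ (A (x + t • e)) e) t := by
    intro t
    simp only [hline]
    have := (hasDerivAt_comp_line (hφ.differentiable (by norm_num)) (A x) e (t * α)).scomp t (hin t)
    simpa [Function.comp_def] using this
  have hψ' : ∀ t : ℝ, HasDerivAt (fun t : ℝ => fderiv ℝ φ (A (x + t • e)) e)
      (α * fderiv ℝ (fderiv ℝ φ) (A (x + t • e)) e e) t := by
    intro t
    simp only [hline]
    have := (hasDerivAt_fderiv_line hφ (A x) e e (t * α)).scomp t (hin t)
    simpa [Function.comp_def] using this
  have hv : ∀ t : ℝ, knappFun l A φ (x + t • e) = w t * φ (A (x + t • e)) := by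
    intro t
    simp only [knappFun, hw, hs]
    congr 2
    simp
    ring
  have hv2 : ContDiff ℝ 2 (knappFun l A φ) := contDiff_knappFun l A hφ
  have h1 : ∀ t : ℝ, fderiv ℝ (knappFun l A φ) (x + t • e) e =
      w t * s * φ (A (x + t • e)) + w t * (α * fderiv ℝ φ (A (x + t • e)) e) := by
    intro t
    have a1 := hasDerivAt_comp_line (hv2.differentiable (by norm_num)) x e t
    simp only [hv] at a1
    exact a1.unique ((hwd t).mul (hψ t))
  have h2 := hasDerivAt_fderiv_line hv2 x e e 0
  simp only [h1] at h2
  have h3 := ((((hwd 0).mul_const s).mul (hψ 0)).add ((hwd 0).mul ((hψ' 0).const_mul (α : ℂ))))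
  have h4 := h2.unique h3
  have h5 : w 0 = Complex.exp (Complex.I * l * (x 0 : ℝ)) := by simp [hw]
  simp only [zero_smul, add_zero, h5] at h4
  rw [h4]
  ring

/-- A bound, up to the factor `l² δ`, for the error made by the Knapp example in the Helmholtz
equation `Δv + l² v = 0`. -/
def knappError (φ : E (n + 1) → ℂ) (y : E (n + 1)) : ℝ :=
  2 * ‖fderiv ℝ φ y (EuclideanSpace.single 0 1)‖ +
    ∑ i, ‖fderiv ℝ (fderiv ℝ φ) y (EuclideanSpace.single i 1) (EuclideanSpace.single i 1)‖

/-- On the scales `(l θ²)⁻¹` along the wave and `(l θ)⁻¹` across it, the drift term `2 i l ∂₀` and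
the transversal second derivatives both have size `l² θ²`. -/
theorem laplacian_knappFun {l θ : ℝ} (hl : 0 < l) (hθ : 0 < θ) (hθ1 : θ ≤ 1) {φ : E (n + 1) → ℂ}
    (hφ : ContDiff ℝ 2 φ) (x : E (n + 1)) :
    ‖(Δ (knappFun l (stretch n (l * θ ^ 2) (l * θ)) φ)) x +
      ((l ^ 2 : ℝ) : ℂ) * knappFun l (stretch n (l * θ ^ 2) (l * θ)) φ x‖ ≤
    l ^ 2 * θ ^ 2 * knappError φ (stretch n (l * θ ^ 2) (l * θ) x) := by
  set A := stretch n (l * θ ^ 2) (l * θ) with hA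
  rw [InnerProductSpace.laplacian_eq_iteratedFDeriv_orthonormalBasis _
    (EuclideanSpace.basisFun (Fin (n + 1)) ℝ)]
  simp only [iteratedFDeriv_two_apply, Matrix.cons_val_zero, Matrix.cons_val_one,
    EuclideanSpace.basisFun_apply]
  simp only [fun i => fderiv_fderiv_knappFun l A hφ x (EuclideanSpace.single i 1) _
    (stretch_single (l * θ ^ 2) (l * θ) i)]
  rw [Fin.sum_univ_succ]
  simp only [Fin.cons_zero, Fin.cons_succ, knappFun]
  set D0 := fderiv ℝ φ (A x) (EuclideanSpace.single 0 1)
  set D2 : Fin (n + 1) → ℂ := fun i => fderiv ℝ (fderiv ℝ φ) (A x) (EuclideanSpace.single i 1)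
    (EuclideanSpace.single i 1) with hD2
  set w := Complex.exp (Complex.I * l * (x 0 : ℝ)) with hw
  have hw1 : ‖w‖ = 1 := by rw [hw, Complex.norm_exp]; simp
  have e1 : w * ((Complex.I * l * (((EuclideanSpace.single 0 1 : E (n + 1)) 0 : ℝ) : ℂ)) ^ 2 *
        φ (A x) + 2 * (Complex.I * l * (((EuclideanSpace.single 0 1 : E (n + 1)) 0 : ℝ) : ℂ)) *
        (((l * θ ^ 2 : ℝ) : ℂ) * D0) + ((l * θ ^ 2 : ℝ) : ℂ) ^ 2 * D2 0) +
      ∑ i : Fin n, w * ((Complex.I * l *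
        (((EuclideanSpace.single i.succ 1 : E (n + 1)) 0 : ℝ) : ℂ)) ^ 2 * φ (A x)
      + 2 * (Complex.I * l * (((EuclideanSpace.single i.succ 1 : E (n + 1)) 0 : ℝ) : ℂ)) *
        (((l * θ : ℝ) : ℂ) * fderiv ℝ φ (A x) (EuclideanSpace.single i.succ 1))
        + ((l * θ : ℝ) : ℂ) ^ 2 * D2 i.succ) + ((l ^ 2 : ℝ) : ℂ) * (w * φ (A x)) =
      ((l ^ 2 * θ ^ 2 : ℝ) : ℂ) * (w * (2 * Complex.I * D0 + ((θ ^ 2 : ℝ) : ℂ) * D2 0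
        + ∑ i : Fin n, D2 i.succ)) := by
    have z : ∀ i : Fin n, ((EuclideanSpace.single i.succ 1 : E (n + 1)) 0 : ℝ) = 0 := by
      intro i; simp [(Fin.succ_ne_zero i).symm]
    have z0 : ((EuclideanSpace.single 0 1 : E (n + 1)) 0 : ℝ) = 1 := by simp
    simp only [z, z0]
    rw [← Finset.mul_sum]
    simp only [Complex.ofReal_zero, mul_zero, zero_mul, zero_add, Complex.ofReal_one, mul_one,
      ne_eq, OfNat.ofNat_ne_zero, not_false_eq_true, zero_pow, ← Finset.mul_sum]
    push_cast
    linear_combination (w * l ^ 2 * φ (A x)) * Complex.I_sq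
  rw [e1, norm_mul, norm_mul, hw1, one_mul, Complex.norm_real, Real.norm_of_nonneg (by positivity)]
  gcongr
  rw [knappError, Fin.sum_univ_succ, ← add_assoc]
  refine (norm_add_le _ _).trans (add_le_add ((norm_add_le _ _).trans (add_le_add ?_ ?_))
    (norm_sum_le _ _))
  · simp [D0]
  · rw [norm_mul, Complex.norm_real, Real.norm_of_nonneg (by positivity)]
    have : θ ^ 2 ≤ 1 := pow_le_one₀ hθ.le hθ1
    exact mul_le_of_le_one_left (norm_nonneg _) this

/-- For every frequency `l` and every `δ` there is a test function, supported in a ball of radius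
`(l δ)⁻¹`, whose quotient decays at the Knapp rate. -/
theorem exists_knapp (n : ℕ) (p : ℝ) (hp : 2 < p) : ∃ K : ℝ, 0 < K ∧ ∀ l δ : ℝ, 0 < l → 0 < δ →
    δ ≤ 1 → ∃ v : 𝓢(E (n + 1), ℂ), HasCompactSupport v ∧
      tsupport v ⊆ Metric.closedBall 0 (l * δ)⁻¹ ∧ 0 < ∫ x, ‖v x‖ ^ p ∧
      Integrable (fun x => ‖v x‖ ^ p) ∧
      (l ^ (n + 1) / l ^ 4 * (‖weakLaplacian (v.toLp 2 volume) +
        ((l ^ 2 : ℝ) : ℂ) • v.toLp 2 volume‖ ^ 2 +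
          δ ^ 2 * l ^ 4 * ‖v.toLp 2 volume‖ ^ 2)) ^ (p / 2) ≤
      K * (l ^ (n + 1) * δ ^ knappExp n p * ∫ x, ‖v x‖ ^ p) := by
  set φ : E (n + 1) → ℂ := fun x => ((radialBump x : ℝ) : ℂ) with hφ
  have hφs : ContDiff ℝ ∞ φ := Complex.ofRealCLM.contDiff.comp contDiff_radialBump
  have hφ2 : ContDiff ℝ 2 φ := hφs.of_le (by norm_cast)
  have hφc : HasCompactSupport φ := hasCompactSupport_radialBump.comp_left (g := Complex.ofReal) rfl
  have hφz : ∀ x, 1 ≤ ‖x‖ → φ x = 0 := fun x hx => by simp [hφ, radialBump_eq_zero hx]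
  have hD1 : Continuous (fderiv ℝ φ) := hφ2.continuous_fderiv (by norm_num)
  have hD2 : Continuous (fderiv ℝ (fderiv ℝ φ)) :=
    (hφ2.fderiv_right (m := 1) (by norm_num)).continuous_fderiv (by norm_num)
  have hHc : Continuous (knappError φ) := by unfold knappError; fun_prop
  set cp : ℝ := ∫ y, ‖φ y‖ ^ p with hcp
  set K0 : ℝ := (∫ y, knappError φ y ^ 2) + ∫ y, ‖φ y‖ ^ 2 with hK0
  have hpc : Continuous fun y => ‖φ y‖ ^ p :=
    hφ2.continuous.norm.rpow_const fun _ => Or.inr (by linarith)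
  have hp0 : p ≠ 0 := (by linarith : (0 : ℝ) < p).ne'
  have hcp0 : 0 < cp := by
    refine hpc.integral_pos_of_hasCompactSupport_nonneg_nonzero
      (hφc.comp_left (g := fun z : ℂ => ‖z‖ ^ p) (by simp [Real.zero_rpow hp0]))
      (fun x => by positivity)
      (x := 0) ?_
    simp [hφ, radialBump_zero]
  have hK00 : 0 < K0 := by
    refine add_pos_of_nonneg_of_pos (integral_nonneg fun y => by positivity) ?_
    have hc2 : Continuous fun y => ‖φ y‖ ^ 2 := by fun_prop
    refine hc2.integral_pos_of_hasCompactSupport_nonneg_nonzero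
      (hφc.comp_left (g := fun z : ℂ => ‖z‖ ^ 2) (by simp)) (fun x => by positivity)
      (x := 0) ?_
    simp [hφ, radialBump_zero]
  refine ⟨K0 ^ (p / 2) / cp, by positivity, ?_⟩
  intro l δ hl hδ hδ1
  -- with `θ² = δ` the errors `‖Δv + l² v‖` and `δ l² ‖v‖` have the same size
  set θ : ℝ := Real.sqrt δ with hθ
  have hθ0 : 0 < θ := Real.sqrt_pos.mpr hδ
  have hθ1 : θ ≤ 1 := Real.sqrt_le_one.mpr hδ1
  have hθδ : θ ^ 2 = δ := Real.sq_sqrt hδ.le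
  set A := stretch n (l * θ ^ 2) (l * θ) with hA
  have hAc : Continuous A := LinearMap.continuous_of_finiteDimensional _
  have hAn : ∀ x, l * δ * ‖x‖ ≤ ‖A x‖ := by
    intro x
    rw [← hθδ]
    exact norm_le_norm_stretch (by positivity)
      (mul_le_mul_of_nonneg_left (by nlinarith) hl.le) x
  set V := knappFun l A φ with hV
  have hVs : ContDiff ℝ ∞ V := contDiff_knappFun l A hφs
  have hVz : ∀ x, (l * δ)⁻¹ ≤ ‖x‖ → V x = 0 := by
    intro x hx
    rw [hV, knappFun, hφz, mul_zero]
    have h1 : 0 < l * δ := by positivity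
    rw [inv_le_iff_one_le_mul₀' h1] at hx
    exact hx.trans (hAn x)
  have hVt : tsupport V ⊆ Metric.closedBall 0 (l * δ)⁻¹ := by
    apply closure_minimal _ Metric.isClosed_closedBall
    intro x hx
    rw [mem_closedBall_zero_iff]
    by_contra! h
    exact hx (hVz x h.le)
  have hVc : HasCompactSupport V := (isCompact_closedBall _ _).of_isClosed_subset
    (isClosed_tsupport _) hVt
  have hVn : ∀ x, ‖V x‖ = ‖φ (A x)‖ := norm_knappFun l A φ
  set v : 𝓢(E (n + 1), ℂ) := hVc.toSchwartzMap hVs with hv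
  have hvV : ∀ x, v x = V x := fun x => rfl
  set D : ℝ := l * θ ^ 2 * (l * θ) ^ n with hD
  have hD0 : 0 < D := by positivity
  have hIv : ∫ x, ‖v x‖ ^ p = D⁻¹ * cp := by
    simp only [hvV, hVn]
    exact integral_comp_stretch (by positivity) (by positivity) hpc
  have hDδ : D = l ^ (n + 1) * δ ^ ((n + 2) / 2 : ℝ) := by
    have : δ ^ ((n + 2) / 2 : ℝ) = θ ^ (n + 2) := by
      rw [hθ, Real.sqrt_eq_rpow, ← Real.rpow_natCast, ← Real.rpow_mul hδ.le]
      push_cast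
      ring_nf
    rw [this, hD]
    ring
  have hpI : Integrable (fun x => ‖v x‖ ^ p) := by
    have h1 : Continuous fun x => ‖v x‖ ^ p :=
      (hVs.continuous.norm).rpow_const fun _ => Or.inr (by linarith)
    refine h1.integrable_of_hasCompactSupport
      (hVc.comp_left (g := fun z : ℂ => ‖z‖ ^ p) (by simp [Real.zero_rpow hp0]))
  refine ⟨v, hVc, hVt, by rw [hIv]; positivity, hpI, ?_⟩
  have hn2 : ‖v.toLp 2 volume‖ ^ 2 = D⁻¹ * ∫ y, ‖φ y‖ ^ 2 := by
    rw [norm_sq_eq_integral]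
    have h1 : (fun x => ‖v.toLp 2 volume x‖ ^ 2) =ᵐ[volume] fun x => ‖φ (A x)‖ ^ 2 := by
      filter_upwards [v.coeFn_toLp 2 volume] with x hx
      rw [hx, hvV, hVn]
    rw [integral_congr_ae h1]
    exact integral_comp_stretch (g := fun y => ‖φ y‖ ^ 2) (by positivity) (by positivity)
      (by fun_prop)
  have hnL : ‖weakLaplacian (v.toLp 2 volume) + ((l ^ 2 : ℝ) : ℂ) • v.toLp 2 volume‖ ^ 2 ≤
      l ^ 4 * δ ^ 2 * (D⁻¹ * ∫ y, knappError φ y ^ 2) := by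
    have hi : Integrable fun x => (l ^ 2 * θ ^ 2 * knappError φ (A x)) ^ 2 := by
      refine Continuous.integrable_of_hasCompactSupport (by fun_prop) ?_
      refine HasCompactSupport.intro (isCompact_closedBall (0 : E (n + 1)) (l * δ)⁻¹) fun x hx => ?_
      rw [mem_closedBall_zero_iff, not_le] at hx
      have h1 : 0 < l * δ := by positivity
      rw [inv_lt_iff_one_lt_mul₀' h1] at hx
      have h2 : 1 < ‖A x‖ := hx.trans_le (hAn x)
      have h3 : φ =ᶠ[𝓝 (A x)] fun _ => 0 := by
        filter_upwards [continuous_norm.continuousAt.eventually (lt_mem_nhds h2)] with y hy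
        exact hφz y hy.le
      have h4 : fderiv ℝ φ =ᶠ[𝓝 (A x)] fun _ => 0 := by
        refine h3.fderiv.trans ?_
        simp only [fderiv_fun_const]
        rfl
      have h5 : fderiv ℝ (fderiv ℝ φ) (A x) = 0 := by rw [h4.fderiv_eq]; simp
      simp [knappError, h5, h4.eq_of_nhds]
    rw [weakLaplacian_schwartz, norm_sq_eq_integral]
    calc _ ≤ ∫ x, (l ^ 2 * θ ^ 2 * knappError φ (A x)) ^ 2 := by
          apply integral_mono_ae (integrable_norm_sq _) hi
          filter_upwards [v.coeFn_toLp 2 volume, (Δ v).coeFn_toLp 2 volume,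
            Lp.coeFn_add ((Δ v).toLp 2 volume) (((l ^ 2 : ℝ) : ℂ) • v.toLp 2 volume),
            Lp.coeFn_smul ((l ^ 2 : ℝ) : ℂ) (v.toLp 2 volume)] with x h1 h2 h3 h4
          have h5 : (((Δ v).toLp 2 volume + ((l ^ 2 : ℝ) : ℂ) • v.toLp 2 volume : L2 (n + 1))) x =
              (Δ V) x + ((l ^ 2 : ℝ) : ℂ) * V x := by
            rw [h3, Pi.add_apply, h4, Pi.smul_apply, h1, h2, SchwartzMap.laplacian_apply]
            rfl
          simp only [h5]
          gcongr
          exact laplacian_knappFun hl hθ0 hθ1 hφ2 x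
      _ = l ^ 4 * δ ^ 2 * (D⁻¹ * ∫ y, knappError φ y ^ 2) := by
          simp only [mul_pow]
          rw [integral_const_mul, integral_comp_stretch (g := fun y => knappError φ y ^ 2)
            (by positivity) (by positivity) (by fun_prop), ← hθδ, ← hD]
          ring
  have hQ : l ^ (n + 1) / l ^ 4 * (‖weakLaplacian (v.toLp 2 volume) +
        ((l ^ 2 : ℝ) : ℂ) • v.toLp 2 volume‖ ^ 2 + δ ^ 2 * l ^ 4 * ‖v.toLp 2 volume‖ ^ 2) ≤
      K0 * δ ^ (2 - (n + 2) / 2 : ℝ) := by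
    have e1 : δ ^ (2 - (n + 2) / 2 : ℝ) = δ ^ 2 / δ ^ ((n + 2) / 2 : ℝ) := by
      rw [Real.rpow_sub hδ]; norm_num
    rw [hn2, e1]
    calc _ ≤ l ^ (n + 1) / l ^ 4 * (l ^ 4 * δ ^ 2 * (D⁻¹ * ∫ y, knappError φ y ^ 2) +
          δ ^ 2 * l ^ 4 * (D⁻¹ * ∫ y, ‖φ y‖ ^ 2)) := by gcongr
      _ = l ^ (n + 1) * δ ^ 2 * D⁻¹ * K0 := by rw [hK0]; field_simp
      _ = _ := by rw [hDδ]; field_simp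
  calc _ ≤ (K0 * δ ^ (2 - (n + 2) / 2 : ℝ)) ^ (p / 2) := by gcongr
    _ = K0 ^ (p / 2) * δ ^ (knappExp n p - (n + 2) / 2) := by
        rw [Real.mul_rpow hK00.le (by positivity), ← Real.rpow_mul hδ.le, knappExp]
        ring_nf
    _ = _ := by
        rw [hIv, hDδ, Real.rpow_sub hδ]
        field_simp

end Knapp

/-! ### Functions supported in a domain -/

section Support

variable {N : ℕ}

theorem weakDeriv_schwartz (i : Fin N) (φ : 𝓢(E N, ℂ)) : weakDeriv i (φ.toLp 2 volume) =
    (∂_{(EuclideanSpace.single i (1 : ℝ) : E N)} φ).toLp 2 volume := by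
  apply l2Rep_eq
  rw [Lp.toTemperedDistribution_toLp_eq, Lp.toTemperedDistribution_toLp_eq,
    TemperedDistribution.lineDerivOp_toTemperedDistributionCLM_eq]

theorem weakDeriv₂_schwartz (i j : Fin N) (φ : 𝓢(E N, ℂ)) : weakDeriv₂ i j (φ.toLp 2 volume) =
    (∂_{(EuclideanSpace.single i (1 : ℝ) : E N)}
      (∂_{(EuclideanSpace.single j (1 : ℝ) : E N)} φ)).toLp 2 volume := by
  apply l2Rep_eq
  rw [Lp.toTemperedDistribution_toLp_eq, Lp.toTemperedDistribution_toLp_eq,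
    TemperedDistribution.lineDerivOp_toTemperedDistributionCLM_eq,
    TemperedDistribution.lineDerivOp_toTemperedDistributionCLM_eq]

theorem lineDerivOp_sub (m : E N) (S T : 𝓢'(E N, ℂ)) : ∂_{m} (S - T) = ∂_{m} S - ∂_{m} T := by
  rw [sub_eq_add_neg, LineDeriv.lineDerivOp_add, LineDeriv.lineDerivOp_neg, sub_eq_add_neg]

theorem sub_mem_H2 {u v : L2 N} (hu : u ∈ H2 N) (hv : v ∈ H2 N) : u - v ∈ H2 N := by
  change MemSobolev 2 2 (Lp.toTemperedDistribution (u - v))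
  rw [toTD_sub]
  exact MemSobolev.sub hu hv

theorem weakDeriv_sub {u v : L2 N} (hu : u ∈ H2 N) (hv : v ∈ H2 N) (i : Fin N) :
    weakDeriv i (u - v) = weakDeriv i u - weakDeriv i v := by
  apply toTD_injective
  rw [toTD_weakDeriv (sub_mem_H2 hu hv), toTD_sub, toTD_sub, toTD_weakDeriv hu, toTD_weakDeriv hv,
    lineDerivOp_sub]

theorem weakDeriv₂_sub {u v : L2 N} (hu : u ∈ H2 N) (hv : v ∈ H2 N) (i j : Fin N) :
    weakDeriv₂ i j (u - v) = weakDeriv₂ i j u - weakDeriv₂ i j v := by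
  apply toTD_injective
  rw [toTD_weakDeriv₂ (sub_mem_H2 hu hv), toTD_sub, toTD_sub, toTD_weakDeriv₂ hu,
    toTD_weakDeriv₂ hv, lineDerivOp_sub, lineDerivOp_sub]

/-- Vanishing outside a measurable set is preserved by limits in `L²`. -/
theorem ae_eq_zero_of_tendsto {Ω : Set (E N)} (hΩ : MeasurableSet Ω) {g : L2 N} {h : ℕ → L2 N}
    (hh : ∀ k, ∀ᵐ x, x ∉ Ω → h k x = 0)
    (ht : Tendsto (fun k => ‖g - h k‖ ^ 2) atTop (𝓝 0)) : ∀ᵐ x, x ∉ Ω → g x = 0 := by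
  have h1 : ∀ k, ∫ x in Ωᶜ, ‖g x‖ ^ 2 ≤ ‖g - h k‖ ^ 2 := by
    intro k
    rw [norm_sq_eq_integral (g - h k)]
    have h2 : ∫ x in Ωᶜ, ‖g x‖ ^ 2 = ∫ x in Ωᶜ, ‖(g - h k) x‖ ^ 2 := by
      apply setIntegral_congr_ae hΩ.compl
      filter_upwards [hh k, Lp.coeFn_sub g (h k)] with x hx hx' hxΩ
      rw [hx', Pi.sub_apply, hx hxΩ, sub_zero]
    rw [h2]
    exact setIntegral_le_integral (integrable_norm_sq _)
      (Eventually.of_forall fun x => by simp only [Pi.zero_apply]; positivity)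
  have h2 : ∫ x in Ωᶜ, ‖g x‖ ^ 2 = 0 :=
    le_antisymm (ge_of_tendsto' ht h1) (integral_nonneg fun x => by positivity)
  rw [integral_eq_zero_iff_of_nonneg (fun x => by positivity) (integrable_norm_sq g).integrableOn]
    at h2
  filter_upwards [(ae_restrict_iff' hΩ.compl).mp h2] with x hx hxΩ
  simpa using hx hxΩ

theorem schwartz_ae_eq_zero {Ω : Set (E N)} {φ : 𝓢(E N, ℂ)} (hφ : tsupport φ ⊆ Ω) :
    ∀ᵐ x, x ∉ Ω → φ.toLp 2 volume x = 0 := by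
  filter_upwards [φ.coeFn_toLp 2 volume] with x hx hxΩ
  rw [hx]
  exact image_eq_zero_of_notMem_tsupport fun h => hxΩ (hφ h)

theorem h2NormSq_bounds (w : L2 N) : ‖w‖ ^ 2 ≤ h2NormSq w ∧
    (∀ i, ‖weakDeriv i w‖ ^ 2 ≤ h2NormSq w) ∧ ∀ i, ‖weakDeriv₂ i i w‖ ^ 2 ≤ h2NormSq w := by
  have n0 := sq_nonneg ‖w‖
  have n1 : 0 ≤ ∑ i, ‖weakDeriv i w‖ ^ 2 := Finset.sum_nonneg fun i _ => sq_nonneg _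
  have n2 : 0 ≤ ∑ i, ∑ j, ‖weakDeriv₂ i j w‖ ^ 2 :=
    Finset.sum_nonneg fun i _ => Finset.sum_nonneg fun j _ => sq_nonneg _
  unfold h2NormSq
  refine ⟨by linarith, fun i => ?_, fun i => ?_⟩
  · have := Finset.single_le_sum (f := fun i => ‖weakDeriv i w‖ ^ 2) (fun i _ => sq_nonneg _)
      (Finset.mem_univ i)
    linarith
  · have h := Finset.single_le_sum (f := fun i => ∑ j, ‖weakDeriv₂ i j w‖ ^ 2)
      (fun i _ => Finset.sum_nonneg fun j _ => sq_nonneg _) (Finset.mem_univ i)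
    have h' := Finset.single_le_sum (f := fun j => ‖weakDeriv₂ i j w‖ ^ 2)
      (fun j _ => sq_nonneg _) (Finset.mem_univ i)
    linarith

/-- Functions in `H²₀(Ω)` and their weak derivatives vanish outside `Ω`. -/
theorem H20_ae_eq_zero {Ω : Set (E N)} (hΩ : MeasurableSet Ω) {u : L2 N} (hu : u ∈ H20 Ω) :
    (∀ᵐ x, x ∉ Ω → u x = 0) ∧ (∀ i, ∀ᵐ x, x ∉ Ω → weakDeriv i u x = 0) ∧
      (∀ᵐ x, x ∉ Ω → weakLaplacian u x = 0) := by
  obtain ⟨huH, φ, hφ, hlim⟩ := hu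
  have hsup : ∀ (k : ℕ) (m : E N), tsupport (∂_{m} (φ k) : 𝓢(E N, ℂ)) ⊆ Ω := fun k m =>
    (SchwartzMap.tsupport_lineDerivOp_subset m (φ k)).trans (hφ k).2
  have hsup₂ : ∀ (k : ℕ) (m : E N),
      tsupport (∂_{m} (∂_{m} (φ k)) : 𝓢(E N, ℂ)) ⊆ Ω := fun k m =>
    (SchwartzMap.tsupport_lineDerivOp_subset m (∂_{m} (φ k))).trans (hsup k m)
  have h0 : ∀ᵐ x, x ∉ Ω → u x = 0 := by
    have ht : Tendsto (fun k => ‖u - (φ k).toLp 2 volume‖ ^ 2) atTop (𝓝 0) :=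
      squeeze_zero (fun k => sq_nonneg _) (fun k => (h2NormSq_bounds _).1) hlim
    exact ae_eq_zero_of_tendsto hΩ (fun k => schwartz_ae_eq_zero (hφ k).2) ht
  have h1 : ∀ i, ∀ᵐ x, x ∉ Ω → weakDeriv i u x = 0 := by
    intro i
    have ht : Tendsto (fun k => ‖weakDeriv i u - weakDeriv i ((φ k).toLp 2 volume)‖ ^ 2)
        atTop (𝓝 0) := by
      refine squeeze_zero (fun k => sq_nonneg _) (fun k => ?_) hlim
      rw [← weakDeriv_sub huH (schwartz_mem_H2 _)]
      exact (h2NormSq_bounds _).2.1 i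
    refine ae_eq_zero_of_tendsto hΩ (fun k => ?_) ht
    rw [weakDeriv_schwartz]
    exact schwartz_ae_eq_zero (hsup k _)
  have h2 : ∀ i, ∀ᵐ x, x ∉ Ω → weakDeriv₂ i i u x = 0 := by
    intro i
    have ht : Tendsto (fun k => ‖weakDeriv₂ i i u - weakDeriv₂ i i ((φ k).toLp 2 volume)‖ ^ 2)
        atTop (𝓝 0) := by
      refine squeeze_zero (fun k => sq_nonneg _) (fun k => ?_) hlim
      rw [← weakDeriv₂_sub huH (schwartz_mem_H2 _)]
      exact (h2NormSq_bounds _).2.2 i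
    refine ae_eq_zero_of_tendsto hΩ (fun k => ?_) ht
    rw [weakDeriv₂_schwartz]
    exact schwartz_ae_eq_zero (hsup₂ k _)
  refine ⟨h0, h1, ?_⟩
  rw [weakLaplacian_eq_sum huH]
  filter_upwards [ae_all_iff.mpr h2, Lp.coeFn_finsetSum Finset.univ
    (fun i => weakDeriv₂ i i u)] with x hx hs hxΩ
  rw [hs, Finset.sum_apply]
  exact Finset.sum_eq_zero fun i _ => hx i hxΩ

theorem lpNormOn_eq {Ω : Set (E N)} {p : ℝ} (hp : 0 < p) (u : L2 N) :
    lpNormOn Ω p u = (∫⁻ x in Ω, ENNReal.ofReal (‖u x‖ ^ p)).toReal ^ (1 / p) := by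
  rw [lpNormOn, eLpNorm_eq_lintegral_rpow_enorm_toReal (by simpa using hp) ENNReal.ofReal_ne_top,
    ENNReal.toReal_ofReal hp.le, ENNReal.toReal_rpow]
  simp only [← ENNReal.ofReal_rpow_of_nonneg (norm_nonneg _) hp.le, ofReal_norm]

/-- On `H²₀(Ω)` the quotient may be computed on the whole space. -/
theorem quotient_eq_univ {Ω : Set (E N)} (hΩ : MeasurableSet Ω) {u : L2 N} (hu : u ∈ H20 Ω)
    (a b : ℝ) {p : ℝ} (hp : 0 < p) : quotient Ω a b p u = quotient Set.univ a b p u := by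
  obtain ⟨h0, h1, h2⟩ := H20_ae_eq_zero hΩ hu
  have e1 : quadForm Ω a b u = quadForm Set.univ a b u := by
    rw [quadForm, quadForm, Measure.restrict_univ, ← integral_indicator hΩ]
    apply integral_congr_ae
    filter_upwards [h0, ae_all_iff.mpr h1, h2] with x x0 x1 x2
    by_cases hx : x ∈ Ω
    · simp [hx]
    · simp [hx, x0 hx, fun i => x1 i hx, x2 hx]
  have e2 : lpNormOn Ω p u = lpNormOn Set.univ p u := by
    rw [lpNormOn_eq hp, lpNormOn_eq hp, Measure.restrict_univ, ← lintegral_indicator hΩ]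
    congr 2
    apply lintegral_congr_ae
    filter_upwards [h0] with x x0
    by_cases hx : x ∈ Ω
    · simp [hx]
    · simp [hx, x0 hx, Real.zero_rpow hp.ne']
  rw [quotient, quotient, e1, e2]

theorem schwartz_mem_H20 {Ω : Set (E N)} {φ : 𝓢(E N, ℂ)} (hc : HasCompactSupport φ)
    (hφ : tsupport φ ⊆ Ω) : φ.toLp 2 volume ∈ H20 Ω := by
  refine ⟨schwartz_mem_H2 φ, fun _ => φ, fun _ => ⟨hc, hφ⟩, ?_⟩
  have hz : (0 : L2 N) = (0 : 𝓢(E N, ℂ)).toLp 2 volume :=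
    (map_zero (SchwartzMap.toLpCLM ℂ ℂ 2 (volume : Measure (E N)))).symm
  have h1 : ∀ i, weakDeriv i (0 : L2 N) = 0 := fun i => by
    have := weakDeriv_sub (schwartz_mem_H2 φ) (schwartz_mem_H2 φ) i
    rwa [sub_self, sub_self] at this
  have h2 : ∀ i j, weakDeriv₂ i j (0 : L2 N) = 0 := fun i j => by
    have := weakDeriv₂_sub (schwartz_mem_H2 φ) (schwartz_mem_H2 φ) i j
    rwa [sub_self, sub_self] at this
  simp [h2NormSq, h1, h2]

end Support

/-! ### Comparison of radial functions with Knapp examples -/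

section Comparison

/-- A radial function whose quotient does not exceed that of the Knapp example forces `δ` to be
bounded below. -/
theorem radial_not_below_knapp (n : ℕ) (hn : 1 ≤ n) (p : ℝ) (hp : 2 < p)
    (hp' : n * p < 2 * (n + 2)) : ∃ C τ : ℝ, 0 < C ∧ 0 < τ ∧
    ∀ l δ : ℝ, 0 < l → 0 < δ → δ ≤ 1 → ∃ v : 𝓢(E (n + 1), ℂ), HasCompactSupport v ∧
      tsupport v ⊆ Metric.closedBall 0 (l * δ)⁻¹ ∧ v.toLp 2 volume ≠ 0 ∧
      ∀ u ∈ H2 (n + 1), IsRadial u → u ≠ 0 →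
        quotient Set.univ (l ^ 2) ((1 + δ ^ 2) * (l ^ 2) ^ 2) p u ≤
          quotient Set.univ (l ^ 2) ((1 + δ ^ 2) * (l ^ 2) ^ 2) p (v.toLp 2 volume) →
        1 ≤ C * δ ^ τ := by
  obtain ⟨C, τ, hC, hτ, hrad⟩ := radial_lower_bound n hn p hp hp'
  obtain ⟨K, hK, hknapp⟩ := exists_knapp n p hp
  have hp0 : 0 < p := by linarith
  refine ⟨C * K, τ, by positivity, hτ, ?_⟩
  intro l δ hl hδ hδ1
  obtain ⟨v, hvc, hvt, hvp, hvi, hvK⟩ := hknapp l δ hl hδ hδ1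
  have hvJ : ∫⁻ x, ENNReal.ofReal (‖v.toLp 2 volume x‖ ^ p) =
      ENNReal.ofReal (∫ x, ‖v x‖ ^ p) := by
    rw [ofReal_integral_eq_lintegral_ofReal hvi (Eventually.of_forall fun x => by
      simp only [Pi.zero_apply]; positivity)]
    apply lintegral_congr_ae
    filter_upwards [v.coeFn_toLp 2 volume] with x hx
    rw [hx]
  refine ⟨v, hvc, hvt, ?_, ?_⟩
  · intro h
    have h1 : ∫⁻ x, ENNReal.ofReal (‖v.toLp 2 volume x‖ ^ p) = 0 := by
      rw [h, ← lintegral_zero (μ := (volume : Measure (E (n + 1))))]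
      apply lintegral_congr_ae
      filter_upwards [Lp.coeFn_zero ℂ 2 (volume : Measure (E (n + 1)))] with x hx
      rw [hx]
      simp [Real.zero_rpow hp0.ne']
    rw [hvJ, ENNReal.ofReal_eq_zero] at h1
    linarith
  intro u hu hur hu0 hle
  set Q : L2 (n + 1) → ℝ := fun w =>
    ‖weakLaplacian w + ((l ^ 2 : ℝ) : ℂ) • w‖ ^ 2 + δ ^ 2 * l ^ 4 * ‖w‖ ^ 2 with hQ
  set Jv : ℝ := ∫ x, ‖v x‖ ^ p with hJv
  set Ju : ℝ := (∫⁻ x, ENNReal.ofReal (‖u x‖ ^ p)).toReal with hJu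
  have hqf : ∀ w ∈ H2 (n + 1),
      quadForm Set.univ (l ^ 2) ((1 + δ ^ 2) * (l ^ 2) ^ 2) w = Q w := by
    intro w hw
    rw [quadForm_univ hw, hQ]
    ring
  have hQu : 0 < Q u := by
    have : 0 < ‖u‖ := norm_pos_iff.mpr hu0
    simp only [hQ]
    positivity
  have hQv : 0 ≤ Q (v.toLp 2 volume) := by simp only [hQ]; positivity
  have hbound := hrad u (Q u) δ l hu hur hQu hδ hδ1 hl le_rfl
  have hfin : ∫⁻ x, ENNReal.ofReal (‖u x‖ ^ p) ≠ ⊤ :=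
    ne_top_of_le_ne_top ENNReal.ofReal_ne_top hbound
  set M : ℝ := l ^ (n + 1) / l ^ 4 with hM
  have hM0 : 0 < M := by positivity
  have hJub : Ju ≤ (l ^ (n + 1))⁻¹ * (C * δ ^ τ * (δ ^ (-knappExp n p) * (M * Q u) ^ (p / 2))) :=
    ENNReal.toReal_le_of_le_ofReal (by positivity) hbound
  have hJu0 : 0 < Ju := by
    refine ENNReal.toReal_pos (fun h => hu0 ?_) hfin
    have hm : AEMeasurable (fun x => ENNReal.ofReal (‖u x‖ ^ p)) volume :=
      (((Lp.aestronglyMeasurable u).norm.aemeasurable).pow_const p).ennreal_ofReal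
    rw [lintegral_eq_zero_iff' hm] at h
    rw [Lp.eq_zero_iff_ae_eq_zero]
    filter_upwards [h] with x hx
    simp only [Pi.zero_apply, ENNReal.ofReal_eq_zero] at hx
    by_contra h0
    have : 0 < ‖u x‖ ^ p := Real.rpow_pos_of_pos (norm_pos_iff.mpr h0) p
    linarith
  rw [quotient, quotient, hqf u hu, hqf _ (schwartz_mem_H2 v), lpNormOn_eq hp0, lpNormOn_eq hp0,
    Measure.restrict_univ, hvJ, ENNReal.toReal_ofReal hvp.le, ← hJu,
    div_le_div_iff₀ (by positivity) (by positivity)] at hle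
  have hpow : ∀ J : ℝ, 0 ≤ J → ((J ^ (1 / p)) ^ 2) ^ (p / 2) = J := by
    intro J hJ
    rw [← Real.rpow_natCast, ← Real.rpow_mul hJ, ← Real.rpow_mul hJ]
    have : 1 / p * (2 : ℕ) * (p / 2) = 1 := by push_cast; field_simp
    rw [this, Real.rpow_one]
  have h1 : Q u ^ (p / 2) * Jv ≤ Q (v.toLp 2 volume) ^ (p / 2) * Ju := by
    have := Real.rpow_le_rpow (by positivity) hle (by positivity : 0 ≤ p / 2)
    rwa [Real.mul_rpow hQu.le (by positivity), Real.mul_rpow hQv (by positivity),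
      hpow _ hvp.le, hpow _ hJu0.le] at this
  have h2 : (M * Q u) ^ (p / 2) * Jv ≤ (M * Q (v.toLp 2 volume)) ^ (p / 2) * Ju := by
    rw [Real.mul_rpow hM0.le hQu.le, Real.mul_rpow hM0.le hQv, mul_assoc, mul_assoc]
    gcongr
  have hpos : 0 < (M * Q u) ^ (p / 2) * Jv := by positivity
  have h3 : (M * Q u) ^ (p / 2) * Jv ≤ C * K * δ ^ τ * ((M * Q u) ^ (p / 2) * Jv) := by
    calc _ ≤ (M * Q (v.toLp 2 volume)) ^ (p / 2) * Ju := h2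
      _ ≤ (K * (l ^ (n + 1) * δ ^ knappExp n p * Jv)) *
          ((l ^ (n + 1))⁻¹ * (C * δ ^ τ * (δ ^ (-knappExp n p) * (M * Q u) ^ (p / 2)))) := by
          gcongr
      _ = _ := by
          rw [Real.rpow_neg hδ.le]
          field_simp
  by_contra! hlt
  nlinarith

end Comparison

end BiharmonicNLS

end

theorem theorem5 (N : ℕ) (hN : 2 ≤ N) (p : ℝ) (hp : 2 < p)
    (hp' : p < (2 * (N : ℝ) + 2) / ((N : ℝ) - 1)) :
    ∃ ε₀ : ℝ, 0 < ε₀ ∧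
      (∀ ε : ℝ, 0 < ε → ε ≤ ε₀ → ∀ u : BiharmonicNLS.L2 N,
        BiharmonicNLS.IsGroundState 1 (1 + ε) p u → ¬ BiharmonicNLS.IsRadial u) ∧
      (∀ ε : ℝ, 0 < ε → ε ≤ ε₀ → ∃ a₀ : ℝ, 0 < a₀ ∧
        ∀ a b : ℝ, a₀ < a → b = (1 + ε) * a ^ 2 → ∀ u : BiharmonicNLS.L2 N,
          BiharmonicNLS.IsDirichletGroundState a b p u → ¬ BiharmonicNLS.IsRadial u) := by
  obtain ⟨n, rfl⟩ : ∃ n, N = n + 1 := ⟨N - 1, by omega⟩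
  have hn : 1 ≤ n := by omega
  have hn0 : (0 : ℝ) < n := by exact_mod_cast hn
  have hp'' : n * p < 2 * (n + 2) := by
    push_cast at hp'
    rw [add_sub_cancel_right, lt_div_iff₀ hn0] at hp'
    linarith
  obtain ⟨C, τ, hC, hτ, hcmp⟩ := BiharmonicNLS.radial_not_below_knapp n hn p hp hp''
  -- `δ = √ε` is small enough to violate `1 ≤ C δ^τ`
  set δ₀ : ℝ := min 1 ((1 / (2 * C)) ^ (1 / τ)) with hδ₀
  have hδ₀0 : 0 < δ₀ := lt_min one_pos (by positivity)
  have hsmall : ∀ ε : ℝ, 0 < ε → ε ≤ δ₀ ^ 2 → Real.sqrt ε ≤ 1 ∧ C * Real.sqrt ε ^ τ < 1 := by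
    intro ε hε hle
    have h1 : Real.sqrt ε ≤ δ₀ := Real.sqrt_le_iff.mpr ⟨hδ₀0.le, hle⟩
    refine ⟨h1.trans (min_le_left _ _), ?_⟩
    have h2 : Real.sqrt ε ^ τ ≤ 1 / (2 * C) := by
      calc _ ≤ ((1 / (2 * C)) ^ (1 / τ)) ^ τ :=
            Real.rpow_le_rpow (Real.sqrt_nonneg _) (h1.trans (min_le_right _ _)) hτ.le
        _ = _ := by rw [← Real.rpow_mul (by positivity), one_div_mul_cancel hτ.ne', Real.rpow_one]
    calc C * Real.sqrt ε ^ τ ≤ C * (1 / (2 * C)) := by gcongr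
      _ = 1 / 2 := by field_simp
      _ < 1 := by norm_num
  refine ⟨δ₀ ^ 2, by positivity, ?_, ?_⟩
  · intro ε hε hle u hu hrad
    obtain ⟨hs1, hs2⟩ := hsmall ε hε hle
    obtain ⟨huX, hu0, -, -, hmin⟩ := hu
    obtain ⟨v, -, -, hv0, hv⟩ := hcmp 1 (Real.sqrt ε) one_pos (Real.sqrt_pos.mpr hε) hs1
    have h1 : (1 + Real.sqrt ε ^ 2) * ((1 : ℝ) ^ 2) ^ 2 = 1 + ε := by
      rw [Real.sq_sqrt hε.le]; ring
    rw [h1, one_pow] at hv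
    have := hv u huX hrad hu0 (hmin ⟨_, BiharmonicNLS.schwartz_mem_H2 v, hv0, rfl⟩)
    linarith
  · intro ε hε hle
    obtain ⟨hs1, hs2⟩ := hsmall ε hε hle
    -- `a ε > 1` puts the support of the Knapp example, of radius `1 / √(a ε)`, into the open ball
    refine ⟨1 / ε, by positivity, ?_⟩
    intro a b ha hb u hu hrad
    obtain ⟨huX, hu0, -, -, hmin⟩ := hu
    have ha0 : 0 < a := lt_trans (by positivity) ha
    have hδ := Real.sqrt_pos.mpr hε
    have hl := Real.sqrt_pos.mpr ha0
    obtain ⟨v, hvc, hvt, hv0, hv⟩ := hcmp (Real.sqrt a) (Real.sqrt ε) hl hδ hs1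
    rw [Real.sq_sqrt ha0.le, Real.sq_sqrt hε.le, ← hb] at hv
    have hball : tsupport v ⊆ Metric.ball 0 1 := by
      refine hvt.trans (Metric.closedBall_subset_ball ?_)
      apply inv_lt_one_of_one_lt₀
      rw [← Real.sqrt_mul ha0.le, Real.lt_sqrt (by norm_num)]
      rw [div_lt_iff₀ hε] at ha
      linarith
    have hvX := BiharmonicNLS.schwartz_mem_H20 hvc hball
    have hq := hmin ⟨_, hvX, hv0, rfl⟩
    have hp0 : 0 < p := by linarith
    rw [BiharmonicNLS.quotient_eq_univ measurableSet_ball huX a b hp0,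
      BiharmonicNLS.quotient_eq_univ measurableSet_ball hvX a b hp0] at hq
    have := hv u huX.1 hrad hu0 hq
    linarith
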